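/- A $k$-graph $\mathcal H=(V,\mathcal E)$ consists of a finite vertex set $V$ and a set $\mathcal E$ of $k$-element subsets of $V$ (edges); it is linear if any two distinct edges share at most one vertex. Two linear orders $<_1,<_2$ on $V$ are monotonically consistent on an edge $e$ if $<_2$ induces on $e$ either the same order as $<_1$ or its reverse. $\mathcal H$ has the weak Erdős–Szekeres property if there is a linear order $<_1$ on $V$ such that for every linear order $<_2$ on $V$ there is an edge on which $<_1$ and $<_2$ are monotonically consistent; it has the strong Erdős–Szekeres property if this holds for every choice of $<_1$. Let $f'_{\mathrm{wES}}(k)$ and $f'_{\mathrm{sES}}(k)$ (resp. $n'_{\mathrm{wES}}(k)$ and $n'_{\mathrm{sES}}(k)$) be the minimum number of edges (resp. vertices) of a linear $k$-graph with the weak and the strong Erdős–Szekeres property. Theorem. For every integer $k\ge 2$ these four minima exist (such linear $k$-graphs exist), and $$\frac{(k!)^2}{8e^2k^4}\le f'_{\mathrm{wES}}(k)\le f'_{\mathrm{sES}}(k)\le (1+o(1))\cdot 16k^8\ln^2 k\cdot\binom{(k-1)^2+1}{k}^2=(1+o(1))\cdot\frac{8k^{2k+7}e^{2k}\ln^2k}{\pi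 e^5},$$ $$\frac{(k-1)\cdot(k-1)!}{2ek}\le n'_{\mathrm{wES}}(k)\le n'_{\mathrm{sES}}(k)\le (1+o(1))\cdot 4k^7\ln k\cdot\binom{(k-1)^2+1}{k}=(1+o(1))\cdot\frac{2\sqrt2\,k^{k+6.5}e^k\ln k}{\sqrt\pi\, e^{2.5}},$$ where $o(1)$ denotes a quantity depending only on $k$ that tends to $0$ as $k\to\infty$. -/

import Mathlib

open Filter Topology Asymptotics
open scoped Nat

/-- A `k`-uniform hypergraph (a `k`-graph) on the vertex set `V`: a finite family of
`k`-element subsets of `V`. -/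
structure KGraph (k : ℕ) (V : Type*) where
  /-- the set of edges -/
  edges : Finset (Finset V)
  uniform : ∀ e ∈ edges, e.card = k

namespace KGraph

/-- A hypergraph is linear if two distinct edges share at most one vertex. -/
def IsLinear {k : ℕ} {V : Type*} (H : KGraph k V) : Prop :=
  ∀ e ∈ H.edges, ∀ f ∈ H.edges, e ≠ f → ((e : Set V) ∩ (f : Set V)).Subsingleton

/-- Two linear orders are monotonically consistent on `e` if the second induces on `e` either
the same order as the first, or the reverse of that order. -/
def MonoConsistent {V : Type*} (r₁ r₂ : LinearOrder V) (e : Finset V) : Prop :=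
  (∀ x ∈ e, ∀ y ∈ e, r₁.lt x y ↔ r₂.lt x y) ∨ (∀ x ∈ e, ∀ y ∈ e, r₁.lt x y ↔ r₂.lt y x)

/-- The weak Erdős–Szekeres property: some linear order is monotonically consistent, on some
edge, with each linear order. -/
def WeakES {k : ℕ} {V : Type*} (H : KGraph k V) : Prop :=
  ∃ r₁ : LinearOrder V, ∀ r₂ : LinearOrder V, ∃ e ∈ H.edges, MonoConsistent r₁ r₂ e

/-- The strong Erdős–Szekeres property: any two linear orders are monotonically consistent on
some edge. -/
def StrongES {k : ℕ} {V : Type*} (H : KGraph k V) : Prop :=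
  ∀ r₁ : LinearOrder V, ∀ r₂ : LinearOrder V, ∃ e ∈ H.edges, MonoConsistent r₁ r₂ e

/-- The numbers of edges of the finite linear `k`-graphs with the weak property. -/
def weakEdgeCounts (k : ℕ) : Set ℕ :=
  {m | ∃ (V : Type) (_ : Finite V) (H : KGraph k V),
    H.IsLinear ∧ H.WeakES ∧ H.edges.card = m}

/-- The numbers of edges of the finite linear `k`-graphs with the strong property. -/
def strongEdgeCounts (k : ℕ) : Set ℕ :=
  {m | ∃ (V : Type) (_ : Finite V) (H : KGraph k V),
    H.IsLinear ∧ H.StrongES ∧ H.edges.card = m}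

/-- The numbers of vertices of the finite linear `k`-graphs with the weak property. -/
def weakVertexCounts (k : ℕ) : Set ℕ :=
  {n | ∃ (V : Type) (_ : Finite V) (H : KGraph k V),
    H.IsLinear ∧ H.WeakES ∧ Nat.card V = n}

/-- The numbers of vertices of the finite linear `k`-graphs with the strong property. -/
def strongVertexCounts (k : ℕ) : Set ℕ :=
  {n | ∃ (V : Type) (_ : Finite V) (H : KGraph k V),
    H.IsLinear ∧ H.StrongES ∧ Nat.card V = n}

/-- The minimum number of edges of a linear `k`-graph with the weak property. -/
noncomputable def fwES (k : ℕ) : ℕ := sInf (weakEdgeCounts k)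

/-- The minimum number of edges of a linear `k`-graph with the strong property. -/
noncomputable def fsES (k : ℕ) : ℕ := sInf (strongEdgeCounts k)

/-- The minimum number of vertices of a linear `k`-graph with the weak property. -/
noncomputable def nwES (k : ℕ) : ℕ := sInf (weakVertexCounts k)

/-- The minimum number of vertices of a linear `k`-graph with the strong property. -/
noncomputable def nsES (k : ℕ) : ℕ := sInf (strongVertexCounts k)

end KGraph

/-!
The lower bounds come from the Lovász local lemma applied to a uniformly random order. A fixed
`j`-set is monotonically consistent with a random order with probability at most `2 / j!`, also
conditionally on any event that ignores the internal arrangement of that set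
(`Equiv.Perm.card_monoOn_and_le`). Hence, if every vertex lies in at most `d` members of a family
of `j`-sets and `2 e j d ≤ j!`, some order avoids the whole family
(`exists_linearOrder_forall_not_monoConsistent`). In a linear `k`-graph on `n` vertices degrees are
at most `(n - 1) / (k - 1)`, which gives the bound on the number of vertices. For the number `m` of
edges, a vertex of maximum degree is deleted from each edge: if a vertex still has degree `d`, the
`d` deleted vertices are distinct and of degree at least `d`, and linearity then forces
`d ^ 2 ≤ 2 m`; the local lemma is applied to the remaining `(k - 1)`-sets.

The upper bounds come from a greedy choice of edges on `n` vertices. Let `M = (k - 1) ^ 2 + 1` and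
let `N` be the binomial coefficient `M.choose k`. While at most `n ^ 2 / k ^ 6` edges are chosen,
the pairs they cover are so few that at least half of the `M`-sets contain no covered pair. By
Erdős–Szekeres each of these contains a `k`-set on which two given orders are consistent, so at
least a fraction `1 / (2 N)` of all `k`-sets can be added without spoiling linearity and is
consistent for those two orders (`KGraph.choose_le_mul_card_filter`). Averaging over the
`(n!) ^ 2` pairs of orders, some new edge takes care of a fraction `1 / (2 N)` of the pairs that
are left (`KGraph.exists_linear_family_card_unhit_le`), so more than `4 N n log n` edges take care
of all. This fits into `n ^ 2 / k ^ 6` edges once `n ≥ 4 k ^ 6 N (log n + 1)`, and as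
`log N ≤ k log k + k`, some `n ~ 4 k ^ 7 N log k` is enough. The closed forms follow from Stirling's
formula and from `∏_{i < k} (M - i) / k ^ 2 → e ^ (-5/2)`.
-/

/-! ### The Lovász local lemma -/

open Classical in
/-- The symmetric Lovász local lemma for the uniform measure on a finite type, in its lopsided form:
only an upper bound on the conditional probability of `A i`, given that events outside the closed
neighbourhood `Γ i` fail, is needed. -/
theorem exists_forall_not_of_local {Ω ι : Type*} [Fintype Ω] [Nonempty Ω]
    (I : Finset ι) (A : ι → Ω → Prop) (Γ : ι → Finset ι) (K : ℕ) (hK : 2 ≤ K) (p : ℝ)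
    (hp0 : 0 ≤ p) (hp : Real.exp 1 * p * K ≤ 1) (hΓ : ∀ i ∈ I, i ∈ Γ i)
    (hcard : ∀ i ∈ I, (Γ i).card ≤ K)
    (hind : ∀ i ∈ I, ∀ S ⊆ I, Disjoint S (Γ i) →
      ((Finset.univ.filter fun ω => A i ω ∧ ∀ s ∈ S, ¬ A s ω).card : ℝ) ≤
        p * (Finset.univ.filter fun ω => ∀ s ∈ S, ¬ A s ω).card) :
    ∃ ω, ∀ i ∈ I, ¬ A i ω := by
  set B : Finset ι → ℝ := fun S => ((Finset.univ.filter fun ω => ∀ s ∈ S, ¬ A s ω).card : ℝ)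
    with hB
  set C : ι → Finset ι → ℝ := fun i S =>
    ((Finset.univ.filter fun ω => A i ω ∧ ∀ s ∈ S, ¬ A s ω).card : ℝ) with hC
  have hK0 : (0 : ℝ) < K := by positivity
  have hK2 : (2 : ℝ) ≤ K := by exact_mod_cast hK
  set y : ℝ := 1 - 1 / K with hy
  have hy0 : 0 < y := by
    have : 1 / (K : ℝ) ≤ 1 / 2 := one_div_le_one_div_of_le (by norm_num) hK2
    linarith
  have hy1 : y ≤ 1 := by
    have : 0 ≤ 1 / (K : ℝ) := by positivity
    linarith
  have hins : ∀ i S, B (insert i S) = B S - C i S := by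
    intro i S
    have h := Finset.card_filter_add_card_filter_not
      (s := Finset.univ.filter fun ω => ∀ s ∈ S, ¬ A s ω) (fun ω => A i ω)
    rw [Finset.filter_filter, Finset.filter_filter] at h
    have h' : B S = C i S + B (insert i S) := by
      simp only [hB, hC]
      rw [← h]
      push_cast
      congr 3
      · ext ω; simp [and_comm]
      · ext ω; simp [and_comm]
    linarith
  have hBnn : ∀ S, 0 ≤ B S := fun S => Nat.cast_nonneg _
  have hmono : ∀ i S T, T ⊆ S → C i S ≤ C i T := by
    intro i S T hTS
    simp only [hC]
    refine Nat.cast_le.2 (Finset.card_le_card fun ω hω => ?_)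
    obtain ⟨-, h1, h2⟩ := Finset.mem_filter.1 hω
    exact Finset.mem_filter.2 ⟨Finset.mem_univ _, h1, fun s hs => h2 s (hTS hs)⟩
  -- the constant: `(1 - 1 / K) ^ (K - 1) ≥ 1 / e`
  have hexp : 1 ≤ Real.exp 1 * y ^ (K - 1) := by
    have hd : ((K - 1 : ℕ) : ℝ) = K - 1 := by rw [Nat.cast_sub (by omega)]; simp
    have hd0 : (0 : ℝ) < K - 1 := by linarith
    have h1 : 1 / y ≤ Real.exp (1 / (K - 1)) := by
      have h2 := Real.add_one_le_exp (1 / ((K : ℝ) - 1))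
      have h3 : 1 / y = 1 / ((K : ℝ) - 1) + 1 := by
        rw [hy]; field_simp; ring
      rw [h3]; exact h2
    have h4 : (1 / y) ^ (K - 1) ≤ Real.exp 1 := by
      calc (1 / y) ^ (K - 1) ≤ (Real.exp (1 / (K - 1))) ^ (K - 1) := by gcongr
        _ = Real.exp 1 := by
          rw [← Real.exp_nat_mul, hd]
          congr 1
          field_simp
    calc (1 : ℝ) = (1 / y) ^ (K - 1) * y ^ (K - 1) := by
          rw [← mul_pow, one_div_mul_cancel hy0.ne', one_pow]
      _ ≤ _ := by gcongr
  -- conditionally on `S` being avoided, every other event has probability at most `1 / K`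
  have key : ∀ S : Finset ι, S ⊆ I → ∀ i ∈ I, i ∉ S → C i S ≤ 1 / K * B S := by
    intro S
    induction S using Finset.strongInduction with
    | H S ih =>
      intro hSI i hi hiS
      -- the neighbours of `i` in `S` are added to `S \ Γ i` one at a time
      have hchain : ∀ T : Finset ι, T ⊆ S ∩ Γ i → y ^ T.card * B (S \ Γ i) ≤ B ((S \ Γ i) ∪ T) := by
        intro T
        induction T using Finset.induction_on with
        | empty => intro _; simp
        | insert a T ha ihT =>
          intro hT
          have haS : a ∈ S ∩ Γ i := hT (Finset.mem_insert_self _ _)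
          have hTS : T ⊆ S ∩ Γ i := (Finset.subset_insert _ _).trans hT
          have hnot : a ∉ (S \ Γ i) ∪ T := by
            simp only [Finset.mem_union, Finset.mem_sdiff, not_or]
            exact ⟨fun h => h.2 (Finset.mem_inter.1 haS).2, ha⟩
          have hsub : (S \ Γ i) ∪ T ⊆ S :=
            Finset.union_subset Finset.sdiff_subset (hTS.trans Finset.inter_subset_left)
          have hss : (S \ Γ i) ∪ T ⊂ S :=
            (Finset.ssubset_iff_of_subset hsub).2 ⟨a, (Finset.mem_inter.1 haS).1, hnot⟩
          have h1 := ih _ hss (hsub.trans hSI) a (hSI (Finset.mem_inter.1 haS).1) hnot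
          have h2 := ihT hTS
          rw [Finset.union_insert, hins, Finset.card_insert_of_notMem ha, pow_succ]
          have h3 : y * B (S \ Γ i ∪ T) ≤ B (S \ Γ i ∪ T) - C a (S \ Γ i ∪ T) := by
            rw [hy]; linarith
          refine le_trans ?_ h3
          calc y ^ T.card * y * B (S \ Γ i) = y * (y ^ T.card * B (S \ Γ i)) := by ring
            _ ≤ _ := by gcongr
      have h1 := hchain _ subset_rfl
      rw [Finset.union_comm, Finset.inter_comm, Finset.inter_comm, Finset.union_comm,
        Finset.sdiff_union_inter] at h1
      have hcd : (S ∩ Γ i).card ≤ K - 1 := by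
        have : S ∩ Γ i ⊆ (Γ i).erase i := by
          intro a ha
          rw [Finset.mem_inter] at ha
          exact Finset.mem_erase.2 ⟨fun h => hiS (h ▸ ha.1), ha.2⟩
        have h2 := Finset.card_le_card this
        rw [Finset.card_erase_of_mem (hΓ i hi)] at h2
        have := hcard i hi
        omega
      have h2 : y ^ (K - 1) * B (S \ Γ i) ≤ B S := by
        refine le_trans ?_ h1
        exact mul_le_mul_of_nonneg_right (pow_le_pow_of_le_one hy0.le hy1 hcd) (hBnn _)
      have h3 : C i S ≤ p * B (S \ Γ i) :=
        (hmono i S _ Finset.sdiff_subset).trans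
          (hind i hi _ (Finset.sdiff_subset.trans hSI) Finset.sdiff_disjoint)
      have hpK : p * Real.exp 1 ≤ 1 / K := by
        rw [le_div_iff₀ hK0]; linarith
      calc C i S ≤ p * (1 * B (S \ Γ i)) := by rw [one_mul]; exact h3
        _ ≤ p * ((Real.exp 1 * y ^ (K - 1)) * B (S \ Γ i)) := by
          gcongr
        _ = p * Real.exp 1 * (y ^ (K - 1) * B (S \ Γ i)) := by ring
        _ ≤ 1 / K * B S := by
          have := hBnn (S \ Γ i)
          gcongr
  have hpos : ∀ S : Finset ι, S ⊆ I → 0 < B S := by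
    intro S
    induction S using Finset.induction_on with
    | empty => intro _; simp [hB, Fintype.card_pos]
    | insert a S ha ihS =>
      intro hS
      have h1 := ihS ((Finset.subset_insert _ _).trans hS)
      have h2 := key S ((Finset.subset_insert _ _).trans hS) a (hS (Finset.mem_insert_self _ _)) ha
      rw [hins]
      have : 0 < y * B S := by positivity
      rw [hy] at this
      linarith
  have h := hpos I subset_rfl
  simp only [hB, Nat.cast_pos, Finset.card_pos] at h
  obtain ⟨ω, hω⟩ := h
  exact ⟨ω, (Finset.mem_filter.1 hω).2⟩

/-! ### Random orders -/

/-- The permutation `σ` is monotone on `e`, increasing or decreasing. -/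
def Equiv.Perm.MonoOn {V : Type*} [LinearOrder V] (σ : Equiv.Perm V) (e : Finset V) : Prop :=
  StrictMonoOn σ e ∨ StrictAntiOn σ e

theorem Equiv.Perm.monoOn_mul_ofSubtype_iff {V : Type*} [LinearOrder V] {e f : Finset V}
    (h : _root_.Disjoint f e) (τ : Equiv.Perm {x // x ∈ e}) (σ : Equiv.Perm V) :
    (σ * Equiv.Perm.ofSubtype τ).MonoOn f ↔ σ.MonoOn f := by
  have hfix : Set.EqOn (σ * Equiv.Perm.ofSubtype τ) σ f := by
    intro x hx
    have hxe : x ∉ e := Finset.disjoint_left.1 h hx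
    simp [Equiv.Perm.ofSubtype_apply_of_not_mem τ hxe]
  exact or_congr hfix.congr_strictMonoOn hfix.congr_strictAntiOn

open Classical in
/-- Among the rearrangements of `σ` on `e`, at most one is increasing on `e` and at most one is
decreasing. -/
theorem Equiv.Perm.card_monoOn_mul_ofSubtype_le {V : Type*} [LinearOrder V] (e : Finset V)
    (σ : Equiv.Perm V) :
    (Finset.univ.filter fun τ : Equiv.Perm {x // x ∈ e} =>
      (σ * Equiv.Perm.ofSubtype τ).MonoOn e).card ≤ 2 := by
  have hval : ∀ (τ : Equiv.Perm {x // x ∈ e}) (x : {x // x ∈ e}),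
      (σ * Equiv.Perm.ofSubtype τ) x = σ (τ x) := by
    intro τ x
    simp [Equiv.Perm.ofSubtype_apply_coe]
  have hrange : ∀ τ : Equiv.Perm {x // x ∈ e},
      Set.range (fun x : {x // x ∈ e} => (σ * Equiv.Perm.ofSubtype τ) x) =
        Set.range (fun x : {x // x ∈ e} => σ x) := by
    intro τ
    simp only [hval]
    exact τ.surjective.range_comp (fun x : {x // x ∈ e} => σ x)
  have heq : ∀ τ τ' : Equiv.Perm {x // x ∈ e},
      (fun x : {x // x ∈ e} => (σ * Equiv.Perm.ofSubtype τ) x) =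
        (fun x : {x // x ∈ e} => (σ * Equiv.Perm.ofSubtype τ') x) → τ = τ' := by
    intro τ τ' h
    ext x
    have := congrFun h x
    simp only [hval] at this
    exact congrArg Subtype.val (Subtype.val_injective (σ.injective this))
  have h1 : (Finset.univ.filter fun τ : Equiv.Perm {x // x ∈ e} =>
      StrictMonoOn (σ * Equiv.Perm.ofSubtype τ) e).card ≤ 1 := by
    rw [Finset.card_le_one]
    intro τ hτ τ' hτ'
    refine heq _ _ (Set.range_injOn_strictMono ?_ ?_ ((hrange τ).trans (hrange τ').symm))
    · exact fun x y hxy => (Finset.mem_filter.1 hτ).2 x.2 y.2 hxy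
    · exact fun x y hxy => (Finset.mem_filter.1 hτ').2 x.2 y.2 hxy
  have h2 : (Finset.univ.filter fun τ : Equiv.Perm {x // x ∈ e} =>
      StrictAntiOn (σ * Equiv.Perm.ofSubtype τ) e).card ≤ 1 := by
    rw [Finset.card_le_one]
    intro τ hτ τ' hτ'
    refine heq _ _ (Set.range_injOn_strictAnti ?_ ?_ ((hrange τ).trans (hrange τ').symm))
    · exact fun x y hxy => (Finset.mem_filter.1 hτ).2 x.2 y.2 hxy
    · exact fun x y hxy => (Finset.mem_filter.1 hτ').2 x.2 y.2 hxy
  refine (Finset.card_le_card fun τ hτ => ?_).trans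
    ((Finset.card_union_le _ _).trans (add_le_add h1 h2))
  exact Finset.mem_union.2 ((Finset.mem_filter.1 hτ).2.imp
    (fun h => Finset.mem_filter.2 ⟨Finset.mem_univ _, h⟩)
    (fun h => Finset.mem_filter.2 ⟨Finset.mem_univ _, h⟩))

open Classical in
/-- Conditionally on an event that does not depend on how `σ` arranges `e`, the permutation `σ` is
monotone on `e` with probability at most `2 / |e|!`. -/
theorem Equiv.Perm.card_monoOn_and_le {V : Type*} [Fintype V] [LinearOrder V] (e : Finset V)
    (B : Equiv.Perm V → Prop)
    (hB : ∀ (τ : Equiv.Perm {x // x ∈ e}) (σ : Equiv.Perm V),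
      B (σ * Equiv.Perm.ofSubtype τ) ↔ B σ) :
    (Finset.univ.filter fun σ : Equiv.Perm V => σ.MonoOn e ∧ B σ).card * (e.card)! ≤
      2 * (Finset.univ.filter B).card := by
  have h1 : ∀ τ : Equiv.Perm {x // x ∈ e},
      (Finset.univ.filter fun σ : Equiv.Perm V => σ.MonoOn e ∧ B σ).card =
      ((Finset.univ.filter B).filter fun σ => (σ * Equiv.Perm.ofSubtype τ).MonoOn e).card := by
    intro τ
    symm
    refine Finset.card_equiv (Equiv.mulRight (Equiv.Perm.ofSubtype τ)) ?_
    intro σ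
    simp [hB, and_comm]
  have h2 : (e.card)! = Fintype.card (Equiv.Perm {x // x ∈ e}) := by
    rw [Fintype.card_perm, Fintype.card_coe]
  calc (Finset.univ.filter fun σ : Equiv.Perm V => σ.MonoOn e ∧ B σ).card * (e.card)!
      = ∑ τ : Equiv.Perm {x // x ∈ e},
        ((Finset.univ.filter B).filter fun σ => (σ * Equiv.Perm.ofSubtype τ).MonoOn e).card := by
        rw [h2, ← Finset.sum_congr rfl (fun τ _ => h1 τ)]
        simp [mul_comm]
    _ = ∑ σ ∈ Finset.univ.filter B, (Finset.univ.filter fun τ : Equiv.Perm {x // x ∈ e} =>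
          (σ * Equiv.Perm.ofSubtype τ).MonoOn e).card :=
        Finset.sum_card_bipartiteAbove_eq_sum_card_bipartiteBelow
          (fun (τ : Equiv.Perm {x // x ∈ e}) (σ : Equiv.Perm V) =>
            (σ * Equiv.Perm.ofSubtype τ).MonoOn e)
    _ ≤ ∑ σ ∈ Finset.univ.filter B, 2 :=
        Finset.sum_le_sum fun σ _ => Equiv.Perm.card_monoOn_mul_ofSubtype_le e σ
    _ = _ := by simp [mul_comm]

open Classical in
/-- A family of `j`-sets of small maximum degree `d` can be avoided: some order is not monotonically
consistent with `r₁` on any member of the family. -/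
theorem exists_linearOrder_forall_not_monoConsistent {V ι : Type*} [Finite V] (r₁ : LinearOrder V)
    (I : Finset ι) (t : ι → Finset V) (j d : ℕ) (hj : 1 ≤ j) (hd : 1 ≤ d)
    (ht : ∀ i ∈ I, (t i).card = j) (hdeg : ∀ v, (I.filter fun i => v ∈ t i).card ≤ d)
    (h : 2 * Real.exp 1 * j * d ≤ (j ! : ℕ)) :
    ∃ r₂ : LinearOrder V, ∀ i ∈ I, ¬ KGraph.MonoConsistent r₁ r₂ (t i) := by
  have := Fintype.ofFinite V
  let := r₁
  -- `2 e ≤ 1` fails, which excludes `j = d = 1`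
  have hK : 2 ≤ j * d := by
    by_contra hcon
    have hj1 : j = 1 := by nlinarith
    have hd1 : d = 1 := by nlinarith
    subst hj1 hd1
    have := Real.add_one_le_exp 1
    norm_num at h
    linarith
  have hjpos : (0 : ℝ) < (j ! : ℕ) := by exact_mod_cast Nat.factorial_pos j
  obtain ⟨σ, hσ⟩ := exists_forall_not_of_local (Ω := Equiv.Perm V) I
    (fun i σ => σ.MonoOn (t i)) (fun i => I.filter fun i' => ¬ Disjoint (t i') (t i))
    (j * d) hK (2 / (j ! : ℕ)) (by positivity) (by
      push_cast
      rw [mul_div_assoc', div_mul_eq_mul_div, div_le_one hjpos]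
      linarith) (by
      intro i hi
      have : (t i).Nonempty := Finset.card_pos.1 (by rw [ht i hi]; omega)
      simp [hi, this.ne_empty]) (by
      intro i hi
      have hsub : (I.filter fun i' => ¬ Disjoint (t i') (t i)) ⊆
          (t i).biUnion fun v => I.filter fun i' => v ∈ t i' := by
        intro i' hi'
        obtain ⟨hi'I, hnd⟩ := Finset.mem_filter.1 hi'
        obtain ⟨v, hv, hv'⟩ := Finset.not_disjoint_iff.1 hnd
        exact Finset.mem_biUnion.2 ⟨v, hv', Finset.mem_filter.2 ⟨hi'I, hv⟩⟩
      calc _ ≤ _ := Finset.card_le_card hsub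
        _ ≤ (t i).card * d := Finset.card_biUnion_le_card_mul _ _ _ fun v _ => hdeg v
        _ = j * d := by rw [ht i hi]) (by
      intro i hi S hS hdisj
      have h1 := Equiv.Perm.card_monoOn_and_le (t i)
        (fun σ : Equiv.Perm V => ∀ s ∈ S, ¬ σ.MonoOn (t s)) (by
          intro τ σ
          refine forall₂_congr fun s hs => not_congr ?_
          refine Equiv.Perm.monoOn_mul_ofSubtype_iff ?_ τ σ
          by_contra hcon
          exact Finset.disjoint_left.1 hdisj hs (Finset.mem_filter.2 ⟨hS hs, hcon⟩))
      rw [ht i hi] at h1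
      rw [div_mul_eq_mul_div, le_div_iff₀ hjpos]
      have h2 := (Nat.cast_le (α := ℝ)).2 h1
      push_cast at h2
      convert h2 <;> rfl)
  refine ⟨LinearOrder.lift' σ σ.injective, fun i hi hcons => hσ i hi ?_⟩
  rcases hcons with hc | hc
  · exact Or.inl fun x hx y hy hxy => (hc x hx y hy).1 hxy
  · exact Or.inr fun x hx y hy hxy => (hc x hx y hy).1 hxy

/-! ### Degrees in linear hypergraphs and the lower bounds -/

namespace KGraph

theorem IsLinear.eq_of_mem {k : ℕ} {V : Type*} {H : KGraph k V} (hH : H.IsLinear) {e f : Finset V}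
    (he : e ∈ H.edges) (hf : f ∈ H.edges) {v w : V} (hvw : v ≠ w) (hve : v ∈ e) (hvf : v ∈ f)
    (hwe : w ∈ e) (hwf : w ∈ f) : e = f := by
  by_contra hne
  exact hvw (hH e he f hf hne ⟨hve, hvf⟩ ⟨hwe, hwf⟩)

theorem MonoConsistent.mono {V : Type*} {r₁ r₂ : LinearOrder V} {e f : Finset V}
    (h : MonoConsistent r₁ r₂ f) (hef : e ⊆ f) : MonoConsistent r₁ r₂ e :=
  h.imp (fun h x hx y hy => h x (hef hx) y (hef hy)) (fun h x hx y hy => h x (hef hx) y (hef hy))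

open Classical in
/-- The edges through a vertex of a linear `k`-graph are disjoint outside of that vertex. -/
theorem IsLinear.mul_degree_le {k : ℕ} {V : Type*} [Fintype V] {H : KGraph k V}
    (hH : H.IsLinear) (v : V) :
    (k - 1) * (H.edges.filter fun e => v ∈ e).card ≤ Fintype.card V - 1 := by
  have hdisj : ((H.edges.filter fun e => v ∈ e : Finset (Finset V)) :
      Set (Finset V)).PairwiseDisjoint (fun e => e.erase v) := by
    intro e he f hf hne
    rw [Function.onFun, Finset.disjoint_left]
    intro w hwe hwf
    obtain ⟨he, hve⟩ := Finset.mem_filter.1 (Finset.mem_coe.1 he)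
    obtain ⟨hf, hvf⟩ := Finset.mem_filter.1 (Finset.mem_coe.1 hf)
    obtain ⟨hwv, hwe⟩ := Finset.mem_erase.1 hwe
    exact hne (hH.eq_of_mem he hf hwv.symm hve hvf hwe (Finset.mem_erase.1 hwf).2)
  have h1 := Finset.card_biUnion hdisj
  rw [Finset.sum_congr rfl (g := fun _ => k - 1) (fun e he => by
    obtain ⟨he, hve⟩ := Finset.mem_filter.1 he
    rw [Finset.card_erase_of_mem hve, H.uniform e he])] at h1
  rw [Finset.sum_const, smul_eq_mul, mul_comm] at h1
  rw [← h1, ← Finset.card_univ, ← Finset.card_erase_of_mem (Finset.mem_univ v)]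
  refine Finset.card_le_card fun w hw => ?_
  obtain ⟨e, -, hw⟩ := Finset.mem_biUnion.1 hw
  exact Finset.mem_erase.2 ⟨(Finset.mem_erase.1 hw).1, Finset.mem_univ _⟩

open Classical in
/-- If `d` vertices of a linear hypergraph have degree at least `d`, then there are at least
`d ^ 2 / 2` edges: the `i`-th vertex contributes at least `d - i` new edges. -/
theorem IsLinear.sq_le_two_mul_card_edges {k : ℕ} {V : Type*} {H : KGraph k V} (hH : H.IsLinear)
    (W : Finset V) (hW : ∀ w ∈ W, W.card ≤ (H.edges.filter fun e => w ∈ e).card) :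
    W.card ^ 2 ≤ 2 * H.edges.card := by
  have key : ∀ U : Finset V, U ⊆ W →
      2 * W.card * U.card ≤
        2 * (H.edges.filter fun e => ∃ u ∈ U, u ∈ e).card + U.card ^ 2 := by
    intro U
    induction U using Finset.induction_on with
    | empty => simp
    | insert w U hw ih =>
      intro hUW
      have ih := ih ((Finset.subset_insert _ _).trans hUW)
      have hdw := hW w (hUW (Finset.mem_insert_self _ _))
      have hsplit : (H.edges.filter fun e => ∃ u ∈ insert w U, u ∈ e) =
          (H.edges.filter fun e => w ∈ e) ∪ (H.edges.filter fun e => ∃ u ∈ U, u ∈ e) := by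
        ext e
        simp only [Finset.mem_insert, exists_eq_or_imp, Finset.mem_filter, Finset.mem_union]
        tauto
      have hinter : ((H.edges.filter fun e => w ∈ e) ∩
          (H.edges.filter fun e => ∃ u ∈ U, u ∈ e)).card ≤ U.card := by
        have hsub : ((H.edges.filter fun e => w ∈ e) ∩
            (H.edges.filter fun e => ∃ u ∈ U, u ∈ e)) ⊆
            U.biUnion fun u => H.edges.filter fun e => w ∈ e ∧ u ∈ e := by
          intro e he
          simp only [Finset.mem_inter, Finset.mem_filter] at he
          obtain ⟨⟨heH, hwe⟩, -, u, hu, hue⟩ := he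
          exact Finset.mem_biUnion.2 ⟨u, hu, Finset.mem_filter.2 ⟨heH, hwe, hue⟩⟩
        refine (Finset.card_le_card hsub).trans ?_
        refine (Finset.card_biUnion_le_card_mul _ _ 1 fun u hu => ?_).trans (mul_one _).le
        rw [Finset.card_le_one]
        intro e he f hf
        obtain ⟨he, hwe, hue⟩ := Finset.mem_filter.1 he
        obtain ⟨hf, hwf, huf⟩ := Finset.mem_filter.1 hf
        exact hH.eq_of_mem he hf (fun h : w = u => hw (by rwa [h])) hwe hwf hue huf
      have hcard := Finset.card_union_add_card_inter (H.edges.filter fun e => w ∈ e)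
        (H.edges.filter fun e => ∃ u ∈ U, u ∈ e)
      rw [hsplit, Finset.card_insert_of_notMem hw]
      nlinarith
  have h1 := key W subset_rfl
  have h2 : (H.edges.filter fun e => ∃ u ∈ W, u ∈ e).card ≤ H.edges.card :=
    Finset.card_filter_le _ _
  nlinarith

theorem WeakES.card_edges_pos {k : ℕ} {V : Type*} {H : KGraph k V} (h : H.WeakES) :
    0 < H.edges.card := by
  obtain ⟨r₁, hr⟩ := h
  obtain ⟨e, he, -⟩ := hr r₁
  exact Finset.card_pos.2 ⟨e, he⟩

theorem le_card_of_weakES {k : ℕ} (hk : 2 ≤ k) {V : Type*} [Finite V] {H : KGraph k V}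
    (hH : H.IsLinear) (hES : H.WeakES) :
    ((k : ℝ) - 1) * (((k - 1)! : ℕ) : ℝ) / (2 * Real.exp 1 * (k : ℝ)) ≤ (Nat.card V : ℝ) := by
  classical
  have := Fintype.ofFinite V
  have hpos := hES.card_edges_pos
  obtain ⟨e₀, he₀⟩ := Finset.card_pos.1 hpos
  have hkn : k ≤ Fintype.card V := by
    rw [← H.uniform e₀ he₀]; exact Finset.card_le_univ _
  set d := (Fintype.card V - 1) / (k - 1) with hd
  have hd1 : 1 ≤ d := (Nat.one_le_div_iff (by omega)).2 (by omega)
  have hdn : (k - 1) * d ≤ Fintype.card V - 1 := Nat.mul_div_le _ _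
  have hdeg : ∀ v, (H.edges.filter fun e => v ∈ e).card ≤ d := by
    intro v
    rw [hd, Nat.le_div_iff_mul_le (by omega), mul_comm]
    convert hH.mul_degree_le v
  have hlt : ((k ! : ℕ) : ℝ) < 2 * Real.exp 1 * k * d := by
    by_contra! hcon
    have hdeg' : ∀ v, (H.edges.filter fun e => v ∈ id e).card ≤ d := hdeg
    obtain ⟨r₁, hr⟩ := hES
    obtain ⟨r₂, hr₂⟩ := exists_linearOrder_forall_not_monoConsistent r₁ H.edges id k d
      (by omega) hd1 (fun e he => H.uniform e he) (fun v => by convert hdeg' v) hcon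
    obtain ⟨e, he, hc⟩ := hr r₂
    exact hr₂ e he hc
  have hk1 : (1 : ℝ) ≤ (k : ℝ) - 1 := by
    have : (2 : ℝ) ≤ k := by exact_mod_cast hk
    linarith
  have hfac : ((k ! : ℕ) : ℝ) = k * ((k - 1)! : ℕ) := by
    exact_mod_cast (Nat.mul_factorial_pred (by omega)).symm
  have hk0 : (0 : ℝ) < k := by linarith
  have he0 := Real.exp_pos 1
  have h1 : (((k - 1)! : ℕ) : ℝ) < 2 * Real.exp 1 * d := by
    rw [hfac] at hlt
    have : (k : ℝ) * ((k - 1)! : ℕ) < k * (2 * Real.exp 1 * d) := by linarith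
    exact lt_of_mul_lt_mul_left this hk0.le
  have h2 : ((k : ℝ) - 1) * d ≤ Nat.card V := by
    rw [Nat.card_eq_fintype_card]
    have : (k - 1) * d ≤ Fintype.card V := by omega
    have h3 : (((k - 1 : ℕ) : ℝ)) * d ≤ Fintype.card V := by exact_mod_cast this
    rwa [Nat.cast_sub (by omega), Nat.cast_one] at h3
  rw [div_le_iff₀ (by positivity)]
  calc ((k : ℝ) - 1) * (((k - 1)! : ℕ) : ℝ) ≤ ((k : ℝ) - 1) * (2 * Real.exp 1 * d) := by gcongr
    _ = (((k : ℝ) - 1) * d) * (2 * Real.exp 1) * 1 := by ring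
    _ ≤ (Nat.card V : ℝ) * (2 * Real.exp 1) * k := by gcongr; linarith
    _ = _ := by ring

/-- The local lemma is applied to the edges trimmed by a vertex of maximum degree: if `d` edges
through `v` keep `v`, they lose `d` distinct vertices of degree at least `d`. -/
theorem le_card_edges_of_weakES {k : ℕ} (hk : 2 ≤ k) {V : Type*} [Finite V] {H : KGraph k V}
    (hH : H.IsLinear) (hES : H.WeakES) :
    ((k ! : ℕ) : ℝ) ^ 2 / (8 * Real.exp 1 ^ 2 * (k : ℝ) ^ 4) ≤ (H.edges.card : ℝ) := by
  classical
  have := Fintype.ofFinite V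
  have hpos := hES.card_edges_pos
  set deg : V → ℕ := fun v => (H.edges.filter fun e => v ∈ e).card with hdeg
  -- a vertex of maximum degree is deleted from every edge
  have hmax : ∀ e : Finset V, ∃ w, e ∈ H.edges → w ∈ e ∧ ∀ v ∈ e, deg v ≤ deg w := by
    intro e
    by_cases he : e ∈ H.edges
    · have hne : e.Nonempty := Finset.card_pos.1 (by rw [H.uniform e he]; omega)
      obtain ⟨w, hw, hw'⟩ := Finset.exists_max_image e deg hne
      exact ⟨w, fun _ => ⟨hw, hw'⟩⟩
    · obtain ⟨e₀, he₀⟩ := Finset.card_pos.1 hpos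
      obtain ⟨w, -⟩ := Finset.card_pos.1 (by rw [H.uniform e₀ he₀]; omega : 0 < e₀.card)
      exact ⟨w, fun h => absurd h he⟩
  choose w hw using hmax
  set d := Nat.sqrt (2 * H.edges.card) with hd
  have hd1 : 1 ≤ d := Nat.le_sqrt.2 (by omega)
  have hdm : d ^ 2 ≤ 2 * H.edges.card := Nat.sqrt_le' _
  have htrim : ∀ v, (H.edges.filter fun e => v ∈ e.erase (w e)).card ≤ d := by
    intro v
    set F := H.edges.filter fun e => v ∈ e.erase (w e) with hF
    have hFmem : ∀ e ∈ F, e ∈ H.edges ∧ v ≠ w e ∧ v ∈ e := by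
      intro e he
      obtain ⟨he, hv⟩ := Finset.mem_filter.1 he
      exact ⟨he, Finset.mem_erase.1 hv⟩
    have hinj : (F.image w).card = F.card := by
      refine Finset.card_image_of_injOn fun e he f hf hef => ?_
      obtain ⟨heH, hve, hve'⟩ := hFmem e he
      obtain ⟨hfH, hvf, hvf'⟩ := hFmem f hf
      exact hH.eq_of_mem heH hfH hve hve' hvf' (hw e heH).1 (hef ▸ (hw f hfH).1)
    rw [hd, Nat.le_sqrt', ← hinj]
    refine hH.sq_le_two_mul_card_edges _ fun u hu => ?_
    obtain ⟨e, he, rfl⟩ := Finset.mem_image.1 hu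
    obtain ⟨heH, hve, hve'⟩ := hFmem e he
    rw [hinj]
    refine le_trans (Finset.card_le_card fun f hf => ?_) ((hw e heH).2 v hve')
    obtain ⟨hfH, hvf, hvf'⟩ := hFmem f hf
    exact Finset.mem_filter.2 ⟨hfH, hvf'⟩
  have hsub : ∀ e : Finset V, e.erase (w e) ⊆ e := fun e => Finset.erase_subset _ _
  have hcard : ∀ e ∈ H.edges, (e.erase (w e)).card = k - 1 := fun e he => by
    rw [Finset.card_erase_of_mem (hw e he).1, H.uniform e he]
  have hlt : (((k - 1)! : ℕ) : ℝ) < 2 * Real.exp 1 * (k - 1 : ℕ) * d := by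
    by_contra! hcon
    obtain ⟨r₁, hr⟩ := hES
    obtain ⟨r₂, hr₂⟩ := exists_linearOrder_forall_not_monoConsistent r₁ H.edges
      _ (k - 1) d (by omega) hd1 hcard (fun v => by convert htrim v) hcon
    obtain ⟨e, he, hc⟩ := hr r₂
    exact hr₂ e he (hc.mono (hsub e))
  have hfac : ((k ! : ℕ) : ℝ) = k * ((k - 1)! : ℕ) := by
    exact_mod_cast (Nat.mul_factorial_pred (by omega)).symm
  have hk0 : (0 : ℝ) < k := by positivity
  have he0 := Real.exp_pos 1
  have hk1 : ((k - 1 : ℕ) : ℝ) ≤ k := by exact_mod_cast Nat.sub_le _ _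
  rw [div_le_iff₀ (by positivity), hfac]
  have hdm' : (d : ℝ) ^ 2 ≤ 2 * H.edges.card := by exact_mod_cast hdm
  calc ((k : ℝ) * ((k - 1)! : ℕ)) ^ 2 ≤ (k * (2 * Real.exp 1 * k * d)) ^ 2 := by
        gcongr
        refine hlt.le.trans ?_
        gcongr
    _ = 4 * Real.exp 1 ^ 2 * k ^ 4 * (d : ℝ) ^ 2 := by ring
    _ ≤ 4 * Real.exp 1 ^ 2 * k ^ 4 * (2 * H.edges.card) := by gcongr
    _ = _ := by ring

end KGraph

/-! ### The Erdős–Szekeres theorem for two orders -/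

theorem le_sub_one_sq_add_one {k : ℕ} (hk : 1 ≤ k) : k ≤ (k - 1) ^ 2 + 1 := by
  obtain ⟨j, rfl⟩ : ∃ j, k = j + 1 := ⟨k - 1, by omega⟩
  rw [Nat.add_sub_cancel]
  nlinarith

/-- Each element of a finite set `S` can be labelled with the size of a longest chain, for a
transitive irreflexive relation, that ends there. -/
theorem Finset.exists_chain_label {V : Type*} (R : V → V → Prop) (hirr : ∀ x, ¬ R x x)
    (htrans : ∀ x y z, R x y → R y z → R x z) (S : Finset V) :
    ∃ a : V → ℕ, (∀ x ∈ S, 1 ≤ a x) ∧ (∀ x ∈ S, ∀ y ∈ S, R x y → a x < a y) ∧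
      ∀ x ∈ S, ∃ T ⊆ S, T.card = a x ∧ ∀ u ∈ T, ∀ v ∈ T, u ≠ v → R u v ∨ R v u := by
  classical
  let F : V → Finset (Finset V) := fun x => S.powerset.filter fun T =>
    x ∈ T ∧ (∀ u ∈ T, u ≠ x → R u x) ∧ ∀ u ∈ T, ∀ v ∈ T, u ≠ v → R u v ∨ R v u
  have hsingle : ∀ x ∈ S, {x} ∈ F x := by
    intro x hx
    simp only [F, Finset.mem_filter, Finset.mem_powerset, Finset.singleton_subset_iff,
      Finset.mem_singleton]
    exact ⟨hx, trivial, fun u hu h => absurd hu h, fun u hu v hv h => absurd (hu.trans hv.symm) h⟩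
  have hle : ∀ x, ∀ T ∈ F x, T.card ≤ (F x).sup Finset.card :=
    fun x T hT => Finset.le_sup (f := Finset.card) hT
  have hatt : ∀ x ∈ S, ∃ T ∈ F x, T.card = (F x).sup Finset.card := by
    intro x hx
    obtain ⟨T, hT, h⟩ := Finset.exists_mem_eq_sup (F x) ⟨_, hsingle x hx⟩ Finset.card
    exact ⟨T, hT, h.symm⟩
  refine ⟨fun x => (F x).sup Finset.card, fun x hx => ?_, fun x hx y hy hxy => ?_, fun x hx => ?_⟩
  · exact (Finset.card_singleton x).symm.le.trans (hle x _ (hsingle x hx))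
  · obtain ⟨T, hT, h⟩ := hatt x hx
    obtain ⟨hTS, hxT, hbelow, hchain⟩ := Finset.mem_filter.1 hT
    have hTy : ∀ u ∈ T, R u y := by
      intro u hu
      by_cases hux : u = x
      · exact hux ▸ hxy
      · exact htrans _ _ _ (hbelow u hu hux) hxy
    have hyT : y ∉ T := fun h => hirr y (hTy y h)
    have hins : insert y T ∈ F y := by
      simp only [F, Finset.mem_filter, Finset.mem_powerset, Finset.mem_insert, true_or, true_and]
      refine ⟨Finset.insert_subset hy (Finset.mem_powerset.1 hTS), ?_, ?_⟩
      · rintro u (rfl | hu) huy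
        · exact absurd rfl huy
        · exact hTy u hu
      · rintro u (rfl | hu) v (rfl | hv) huv
        · exact absurd rfl huv
        · exact Or.inr (hTy v hv)
        · exact Or.inl (hTy u hu)
        · exact hchain u hu v hv huv
    have := hle y _ hins
    rw [Finset.card_insert_of_notMem hyT] at this
    show (F x).sup Finset.card < (F y).sup Finset.card
    omega
  · obtain ⟨T, hT, h⟩ := hatt x hx
    obtain ⟨hTS, hxT, hbelow, hchain⟩ := Finset.mem_filter.1 hT
    exact ⟨T, Finset.mem_powerset.1 hTS, h, hchain⟩

namespace KGraph

/-- The **Erdős–Szekeres theorem**. -/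
theorem exists_monoConsistent_of_sq_lt {V : Type*} (r₁ r₂ : LinearOrder V) {k : ℕ} (S : Finset V)
    (hS : (k - 1) ^ 2 < S.card) : ∃ e ⊆ S, e.card = k ∧ MonoConsistent r₁ r₂ e := by
  classical
  have irr₁ : ∀ x, ¬ r₁.lt x x := fun x => @lt_irrefl _ r₁.toPreorder x
  have irr₂ : ∀ x, ¬ r₂.lt x x := fun x => @lt_irrefl _ r₂.toPreorder x
  have tr₁ : ∀ x y z, r₁.lt x y → r₁.lt y z → r₁.lt x z :=
    fun x y z => @lt_trans _ r₁.toPreorder x y z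
  have tr₂ : ∀ x y z, r₂.lt x y → r₂.lt y z → r₂.lt x z :=
    fun x y z => @lt_trans _ r₂.toPreorder x y z
  have tri₁ : ∀ x y, x ≠ y → r₁.lt x y ∨ r₁.lt y x := fun x y h => @lt_or_gt_of_ne _ r₁ x y h
  have tri₂ : ∀ x y, x ≠ y → r₂.lt x y ∨ r₂.lt y x := fun x y h => @lt_or_gt_of_ne _ r₂ x y h
  obtain ⟨a, ha1, halt, hachain⟩ := Finset.exists_chain_label
    (fun x y => r₁.lt x y ∧ r₂.lt x y) (fun x h => irr₁ x h.1)
    (fun x y z h h' => ⟨tr₁ _ _ _ h.1 h'.1, tr₂ _ _ _ h.2 h'.2⟩) S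
  obtain ⟨b, hb1, hblt, hbchain⟩ := Finset.exists_chain_label
    (fun x y => r₁.lt x y ∧ r₂.lt y x) (fun x h => irr₁ x h.1)
    (fun x y z h h' => ⟨tr₁ _ _ _ h.1 h'.1, tr₂ _ _ _ h'.2 h.2⟩) S
  by_cases hak : ∃ x ∈ S, k ≤ a x
  · obtain ⟨x, hx, hk⟩ := hak
    obtain ⟨T, hTS, hT, hc⟩ := hachain x hx
    obtain ⟨e, heT, he⟩ := Finset.exists_subset_card_eq (hk.trans hT.symm.le)
    refine ⟨e, heT.trans hTS, he, Or.inl fun u hu v hv => ?_⟩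
    by_cases huv : u = v
    · subst huv; exact iff_of_false (irr₁ u) (irr₂ u)
    rcases hc u (heT hu) v (heT hv) huv with h | h
    · exact iff_of_true h.1 h.2
    · exact iff_of_false (fun h' => irr₁ _ (tr₁ _ _ _ h' h.1)) (fun h' => irr₂ _ (tr₂ _ _ _ h' h.2))
  by_cases hbk : ∃ x ∈ S, k ≤ b x
  · obtain ⟨x, hx, hk⟩ := hbk
    obtain ⟨T, hTS, hT, hc⟩ := hbchain x hx
    obtain ⟨e, heT, he⟩ := Finset.exists_subset_card_eq (hk.trans hT.symm.le)
    refine ⟨e, heT.trans hTS, he, Or.inr fun u hu v hv => ?_⟩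
    by_cases huv : u = v
    · subst huv; exact iff_of_false (irr₁ u) (irr₂ u)
    rcases hc u (heT hu) v (heT hv) huv with h | h
    · exact iff_of_true h.1 h.2
    · exact iff_of_false (fun h' => irr₁ _ (tr₁ _ _ _ h' h.1)) (fun h' => irr₂ _ (tr₂ _ _ _ h.2 h'))
  push Not at hak hbk
  exfalso
  have hmaps : ∀ x ∈ S, (a x, b x) ∈ Finset.Ico 1 k ×ˢ Finset.Ico 1 k := fun x hx =>
    Finset.mem_product.2 ⟨Finset.mem_Ico.2 ⟨ha1 x hx, hak x hx⟩,
      Finset.mem_Ico.2 ⟨hb1 x hx, hbk x hx⟩⟩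
  obtain ⟨x, hx, y, hy, hxy, heq⟩ := Finset.exists_ne_map_eq_of_card_lt_of_maps_to
    (by rw [Finset.card_product, Nat.card_Ico, ← sq]; exact hS) hmaps
  obtain ⟨hab, hbb⟩ := Prod.mk.inj heq
  rcases tri₁ x y hxy with h1 | h1 <;> rcases tri₂ x y hxy with h2 | h2
  · exact (halt x hx y hy ⟨h1, h2⟩).ne hab
  · exact (hblt x hx y hy ⟨h1, h2⟩).ne hbb
  · exact (hblt y hy x hx ⟨h1, h2⟩).ne hbb.symm
  · exact (halt y hy x hx ⟨h1, h2⟩).ne hab.symm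

end KGraph

/-! ### Supersaturation among the sets that respect a linear hypergraph -/

open Classical in
theorem Finset.card_filter_superset_powersetCard_le {V : Type*} [Fintype V] (p : Finset V)
    (M : ℕ) : (((Finset.univ : Finset V).powersetCard M).filter fun S => p ⊆ S).card ≤
      (Fintype.card V - p.card).choose (M - p.card) := by
  rw [← Finset.card_compl, ← Finset.card_powersetCard]
  refine Finset.card_le_card_of_injOn (fun S => S \ p) ?_ ?_
  · intro S hS
    obtain ⟨hS, hpS⟩ := Finset.mem_filter.1 (Finset.mem_coe.1 hS)
    refine Finset.mem_coe.2 (Finset.mem_powersetCard.2 ⟨fun x hx => ?_, ?_⟩)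
    · exact Finset.mem_compl.2 (Finset.mem_sdiff.1 hx).2
    · rw [Finset.card_sdiff_of_subset hpS, (Finset.mem_powersetCard.1 hS).2]
  · intro S hS T hT hST
    obtain ⟨-, hpS⟩ := Finset.mem_filter.1 (Finset.mem_coe.1 hS)
    obtain ⟨-, hpT⟩ := Finset.mem_filter.1 (Finset.mem_coe.1 hT)
    rw [← Finset.sdiff_union_of_subset hpS, ← Finset.sdiff_union_of_subset hpT]
    exact congrArg (· ∪ p) hST

open Classical in
/-- If the edges in `E` cover few pairs, then at least half of the `M`-sets contain no covered
pair. -/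
theorem Finset.choose_le_two_mul_card_filter_inter_le_one {V : Type*} [Fintype V] {k m M : ℕ}
    (hM : 2 ≤ M) (E : Finset (Finset V)) (hE : ∀ e ∈ E, e.card = k)
    (hEm : E.card ≤ m)
    (h : 2 * m * k.choose 2 * M.choose 2 ≤ (Fintype.card V).choose 2) :
    (Fintype.card V).choose M ≤
      2 * (((Finset.univ : Finset V).powersetCard M).filter
        fun S => ∀ f ∈ E, (S ∩ f).card ≤ 1).card := by
  set n := Fintype.card V
  set X := (Finset.univ : Finset V).powersetCard M with hX
  have hXc : X.card = n.choose M := by rw [hX, Finset.card_powersetCard, Finset.card_univ]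
  have hbad : (X.filter fun S => ¬ ∀ f ∈ E, (S ∩ f).card ≤ 1).card ≤
      m * (k.choose 2 * (n - 2).choose (M - 2)) := by
    have hsub : (X.filter fun S => ¬ ∀ f ∈ E, (S ∩ f).card ≤ 1) ⊆
        E.biUnion fun f => (f.powersetCard 2).biUnion fun p => X.filter fun S => p ⊆ S := by
      intro S hS
      obtain ⟨hSX, hS⟩ := Finset.mem_filter.1 hS
      push Not at hS
      obtain ⟨f, hf, hSf⟩ := hS
      obtain ⟨p, hp, hpc⟩ := Finset.exists_subset_card_eq (Nat.succ_le_of_lt hSf)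
      refine Finset.mem_biUnion.2 ⟨f, hf, Finset.mem_biUnion.2 ⟨p, ?_, ?_⟩⟩
      · exact Finset.mem_powersetCard.2 ⟨hp.trans Finset.inter_subset_right, hpc⟩
      · exact Finset.mem_filter.2 ⟨hSX, hp.trans Finset.inter_subset_left⟩
    refine (Finset.card_le_card hsub).trans ?_
    refine (Finset.card_biUnion_le_card_mul _ _ _ fun f hf => ?_).trans
      (Nat.mul_le_mul_right _ hEm)
    have hfc : (f.powersetCard 2).card = k.choose 2 := by
      rw [Finset.card_powersetCard, hE f hf]
    rw [← hfc]
    refine Finset.card_biUnion_le_card_mul _ _ _ fun p hp => ?_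
    have := Finset.card_filter_superset_powersetCard_le p M
    rwa [(Finset.mem_powersetCard.1 hp).2] at this
  have hsplit := Finset.card_filter_add_card_filter_not (s := X)
    (fun S => ∀ f ∈ E, (S ∩ f).card ≤ 1)
  rw [hXc] at hsplit
  have hmul : n.choose M * M.choose 2 = n.choose 2 * (n - 2).choose (M - 2) := Nat.choose_mul hM
  have hM2 : 0 < M.choose 2 := Nat.choose_pos hM
  have h2 : 2 * (X.filter fun S => ¬ ∀ f ∈ E, (S ∩ f).card ≤ 1).card ≤ n.choose M := by
    refine Nat.le_of_mul_le_mul_right ?_ hM2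
    calc 2 * (X.filter fun S => ¬ ∀ f ∈ E, (S ∩ f).card ≤ 1).card * M.choose 2
        ≤ 2 * (m * (k.choose 2 * (n - 2).choose (M - 2))) * M.choose 2 := by gcongr
      _ = (2 * m * k.choose 2 * M.choose 2) * (n - 2).choose (M - 2) := by ring
      _ ≤ n.choose 2 * (n - 2).choose (M - 2) := by gcongr
      _ = _ := hmul.symm
  omega

namespace KGraph

open Classical in
/-- If every `M`-set contains a `k`-set with the property `Q`, then a positive proportion of all
`k`-sets, at least half of the `1 / M.choose k` that averaging gives, has the property `Q` and
meets every member of `E` in at most one vertex. -/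
theorem choose_le_mul_card_filter {V : Type*} [Fintype V] {k m M : ℕ} (hk : 2 ≤ k)
    (hkM : k ≤ M) (hMn : M ≤ Fintype.card V) (E : Finset (Finset V)) (hE : ∀ e ∈ E, e.card = k)
    (hEm : E.card ≤ m) (h : 2 * m * k.choose 2 * M.choose 2 ≤ (Fintype.card V).choose 2)
    (Q : Finset V → Prop) (hQ : ∀ S : Finset V, S.card = M → ∃ e ⊆ S, e.card = k ∧ Q e) :
    (Fintype.card V).choose k ≤ 2 * M.choose k *
      (((Finset.univ : Finset V).powersetCard k).filter
        fun e => (∀ f ∈ E, (e ∩ f).card ≤ 1) ∧ Q e).card := by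
  have h1 := Finset.choose_le_two_mul_card_filter_inter_le_one (hk.trans hkM) E hE hEm h
  set n := Fintype.card V
  set G := ((Finset.univ : Finset V).powersetCard k).filter
    fun e => (∀ f ∈ E, (e ∩ f).card ≤ 1) ∧ Q e with hG
  set X := (Finset.univ : Finset V).powersetCard M with hX
  have h2 : (X.filter fun S => ∀ f ∈ E, (S ∩ f).card ≤ 1).card ≤
      G.card * (n - k).choose (M - k) := by
    have hsub : (X.filter fun S => ∀ f ∈ E, (S ∩ f).card ≤ 1) ⊆
        G.biUnion fun e => X.filter fun S => e ⊆ S := by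
      intro S hS
      obtain ⟨hSX, hS⟩ := Finset.mem_filter.1 hS
      obtain ⟨e, heS, hec, hQe⟩ := hQ S (Finset.mem_powersetCard.1 hSX).2
      refine Finset.mem_biUnion.2 ⟨e, Finset.mem_filter.2 ⟨?_, ?_, hQe⟩,
        Finset.mem_filter.2 ⟨hSX, heS⟩⟩
      · exact Finset.mem_powersetCard.2 ⟨Finset.subset_univ _, hec⟩
      · exact fun f hf =>
          (Finset.card_le_card (Finset.inter_subset_inter_right heS)).trans (hS f hf)
    refine (Finset.card_le_card hsub).trans
      (Finset.card_biUnion_le_card_mul _ _ _ fun e he => ?_)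
    have := Finset.card_filter_superset_powersetCard_le e M
    rwa [(Finset.mem_powersetCard.1 (Finset.mem_filter.1 he).1).2] at this
  have hmul : n.choose M * M.choose k = n.choose k * (n - k).choose (M - k) := Nat.choose_mul hkM
  refine Nat.le_of_mul_le_mul_right ?_
    (Nat.choose_pos (by omega) : 0 < (n - k).choose (M - k))
  rw [← hmul]
  calc n.choose M * M.choose k
      ≤ (2 * (G.card * (n - k).choose (M - k))) * M.choose k :=
        Nat.mul_le_mul_right _ (h1.trans (Nat.mul_le_mul_left 2 h2))
    _ = _ := by ring

/-! ### The greedy choice of edges -/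

open Classical in
/-- Greedy covering. Suppose that, whatever linear family `E` of at most `m` sets of size `k` has
been chosen, every `p : P` is hit by at least a fraction `1 / c` of all `k`-sets that extend
`E`. Then the number of unhit `p` can be reduced by a factor `1 - 1 / c` with each new edge. -/
theorem exists_linear_family_card_unhit_le {V P : Type*} [Fintype V] [Fintype P] {k m c : ℕ}
    (hkV : k ≤ Fintype.card V) (hc : 0 < c) (hit : Finset V → P → Prop)
    (h : ∀ E : Finset (Finset V), (∀ e ∈ E, e.card = k) → E.card ≤ m → ∀ p,
      (Fintype.card V).choose k ≤ c * (((Finset.univ : Finset V).powersetCard k).filter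
        fun e => (∀ f ∈ E, (e ∩ f).card ≤ 1) ∧ hit e p).card) :
    ∀ i ≤ m, ∃ E : Finset (Finset V), (∀ e ∈ E, e.card = k) ∧
      (∀ e ∈ E, ∀ f ∈ E, e ≠ f → ((e : Set V) ∩ (f : Set V)).Subsingleton) ∧ E.card ≤ i ∧
      ((Finset.univ.filter fun p => ∀ e ∈ E, ¬ hit e p).card : ℝ) ≤
        Fintype.card P * (1 - 1 / (c : ℝ)) ^ i := by
  have hc0 : (0 : ℝ) < c := by exact_mod_cast hc
  have hy : 0 ≤ 1 - 1 / (c : ℝ) := by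
    rw [sub_nonneg, div_le_one hc0]; exact_mod_cast hc
  have hsub : ∀ e f : Finset V, (e ∩ f).card ≤ 1 →
      ((e : Set V) ∩ (f : Set V)).Subsingleton := fun e f h x hx y hy =>
    Finset.card_le_one.1 h x (Finset.mem_inter.2 hx) y (Finset.mem_inter.2 hy)
  intro i
  induction i with
  | zero => intro _; exact ⟨∅, by simp⟩
  | succ i ih =>
    intro him
    obtain ⟨E, hEk, hElin, hEi, hEU⟩ := ih (by omega)
    set U := Finset.univ.filter fun p => ∀ e ∈ E, ¬ hit e p with hU
    rcases U.eq_empty_or_nonempty with hUe | hUne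
    · refine ⟨E, hEk, hElin, by omega, ?_⟩
      rw [← hU, hUe]
      simp only [Finset.card_empty, Nat.cast_zero]
      positivity
    set X := ((Finset.univ : Finset V).powersetCard k).filter
      fun e => ∀ f ∈ E, (e ∩ f).card ≤ 1 with hX
    have hXc : X.card ≤ (Fintype.card V).choose k := by
      refine (Finset.card_filter_le _ _).trans ?_
      rw [Finset.card_powersetCard, Finset.card_univ]
    have hN : 0 < (Fintype.card V).choose k := Nat.choose_pos hkV
    have hlow : ∀ p ∈ U, (Fintype.card V).choose k ≤ c * (X.filter fun e => hit e p).card := by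
      intro p _
      have := h E hEk (by omega) p
      rwa [← Finset.filter_filter] at this
    have hsum : ∑ e ∈ X, (U.filter fun p => hit e p).card =
        ∑ p ∈ U, (X.filter fun e => hit e p).card :=
      Finset.sum_card_bipartiteAbove_eq_sum_card_bipartiteBelow hit
    obtain ⟨e, heX, he⟩ : ∃ e ∈ X, U.card ≤ c * (U.filter fun p => hit e p).card := by
      by_contra! hcon
      obtain ⟨p, hp⟩ := hUne
      have hXne : X.Nonempty := by
        rw [Finset.nonempty_iff_ne_empty]
        intro hX0
        have := hlow p hp
        rw [hX0] at this
        simp at this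
        omega
      have h1 : ∑ e ∈ X, c * (U.filter fun p => hit e p).card < X.card * U.card := by
        have := Finset.sum_lt_sum_of_nonempty hXne hcon
        simpa using this
      have h2 : U.card * (Fintype.card V).choose k ≤
          ∑ p ∈ U, c * (X.filter fun e => hit e p).card := by
        have := Finset.sum_le_sum hlow
        simpa using this
      rw [← Finset.mul_sum] at h1 h2
      rw [hsum] at h1
      have h3 := Nat.mul_le_mul_right U.card hXc
      nlinarith
    obtain ⟨hek, hef⟩ := Finset.mem_filter.1 heX
    refine ⟨insert e E, ?_, ?_, (Finset.card_insert_le _ _).trans (by omega), ?_⟩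
    · intro f hf
      rcases Finset.mem_insert.1 hf with rfl | hf
      · exact (Finset.mem_powersetCard.1 hek).2
      · exact hEk f hf
    · intro f hf g hg hfg
      rcases Finset.mem_insert.1 hf with rfl | hf <;> rcases Finset.mem_insert.1 hg with rfl | hg
      · exact absurd rfl hfg
      · exact hsub _ _ (hef g hg)
      · rw [Set.inter_comm]; exact hsub _ _ (hef f ‹f ∈ E›)
      · exact hElin f hf g hg hfg
    · have hUsplit := Finset.card_filter_add_card_filter_not (s := U) (fun p => hit e p)
      have hU' : (Finset.univ.filter fun p => ∀ f ∈ insert e E, ¬ hit f p) =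
          U.filter fun p => ¬ hit e p := by
        ext p
        simp [hU, and_comm]
      rw [hU']
      have h1 : ((U.filter fun p => ¬ hit e p).card : ℝ) =
          U.card - (U.filter fun p => hit e p).card := by
        rw [← hUsplit]; push_cast; ring
      have h2 : (U.card : ℝ) ≤ c * (U.filter fun p => hit e p).card := by exact_mod_cast he
      have h3 : (U.card : ℝ) * (1 / c) ≤ (U.filter fun p => hit e p).card := by
        rw [mul_one_div, div_le_iff₀ hc0]; linarith
      calc ((U.filter fun p => ¬ hit e p).card : ℝ) ≤ U.card * (1 - 1 / c) := by
            rw [h1]; linarith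
        _ ≤ (Fintype.card P * (1 - 1 / (c : ℝ)) ^ i) * (1 - 1 / c) := by gcongr
        _ = _ := by rw [pow_succ]; ring

theorem exists_equiv_fin_lt_iff {V : Type*} [LinearOrder V] [Fintype V] {n : ℕ}
    (h : Fintype.card V = n) : ∃ σ : V ≃ Fin n, ∀ x y, x < y ↔ σ x < σ y := by
  let e := Fintype.orderIsoFinOfCardEq V h
  exact ⟨e.symm.toEquiv, fun x y => e.symm.lt_iff_lt.symm⟩

/-- The linear order induced by a permutation of `Fin n`. -/
abbrev permOrder {n : ℕ} (σ : Equiv.Perm (Fin n)) : LinearOrder (Fin n) :=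
  LinearOrder.lift' σ σ.injective

theorem MonoConsistent.congr {V : Type*} {r₁ r₁' r₂ r₂' : LinearOrder V} {e : Finset V}
    (h₁ : ∀ x y, r₁.lt x y ↔ r₁'.lt x y) (h₂ : ∀ x y, r₂.lt x y ↔ r₂'.lt x y)
    (h : MonoConsistent r₁ r₂ e) : MonoConsistent r₁' r₂' e :=
  h.imp (fun h x hx y hy => (h₁ x y).symm.trans ((h x hx y hy).trans (h₂ x y)))
    (fun h x hx y hy => (h₁ x y).symm.trans ((h x hx y hy).trans (h₂ y x)))

theorem exists_permOrder {n : ℕ} (r : LinearOrder (Fin n)) :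
    ∃ σ : Equiv.Perm (Fin n), ∀ x y, (permOrder σ).lt x y ↔ r.lt x y := by
  obtain ⟨σ, hσ⟩ := @exists_equiv_fin_lt_iff (Fin n) r _ n (Fintype.card_fin n)
  exact ⟨σ, fun x y => (hσ x y).symm⟩

theorem exists_isLinear_strongES {k n m : ℕ} (hk : 2 ≤ k) (hMn : (k - 1) ^ 2 + 1 ≤ n)
    (h : 2 * m * k.choose 2 * ((k - 1) ^ 2 + 1).choose 2 ≤ n.choose 2)
    (hm : ((n ! : ℕ) : ℝ) ^ 2 * (1 - 1 / (2 * ((k - 1) ^ 2 + 1).choose k : ℝ)) ^ m < 1) :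
    ∃ H : KGraph k (Fin n), H.IsLinear ∧ H.StrongES ∧ H.edges.card ≤ m := by
  classical
  have hkM : k ≤ (k - 1) ^ 2 + 1 := le_sub_one_sq_add_one (by omega)
  have hN : 0 < ((k - 1) ^ 2 + 1).choose k := Nat.choose_pos hkM
  obtain ⟨hit, hhit⟩ : ∃ hit : Finset (Fin n) → Equiv.Perm (Fin n) × Equiv.Perm (Fin n) → Prop,
      ∀ e p, hit e p ↔ MonoConsistent (permOrder p.1) (permOrder p.2) e := ⟨_, fun _ _ => Iff.rfl⟩
  obtain ⟨E, hEk, hElin, hEm, hEU⟩ := exists_linear_family_card_unhit_le (V := Fin n)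
    (P := Equiv.Perm (Fin n) × Equiv.Perm (Fin n)) (k := k) (m := m)
    (c := 2 * ((k - 1) ^ 2 + 1).choose k) (by rw [Fintype.card_fin]; omega) (by omega) hit
    (fun E hE hEm p => by
      have := choose_le_mul_card_filter hk hkM (by rwa [Fintype.card_fin]) E hE hEm
        (by rwa [Fintype.card_fin]) (fun e => hit e p) (fun S hS => by
          simp only [hhit]
          exact exists_monoConsistent_of_sq_lt _ _ S (by omega))
      convert this) m le_rfl
  set U := Finset.univ.filter fun p : Equiv.Perm (Fin n) × Equiv.Perm (Fin n) =>
    ∀ e ∈ E, ¬ hit e p with hU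
  have hU0 : (U.card : ℝ) < 1 := by
    have hcard : Fintype.card (Equiv.Perm (Fin n) × Equiv.Perm (Fin n)) = n ! ^ 2 := by
      rw [Fintype.card_prod, Fintype.card_perm, Fintype.card_fin, sq]
    rw [hcard] at hEU
    push_cast at hEU
    refine lt_of_le_of_lt (le_trans (le_of_eq ?_) hEU) hm
    congr!
  have hU1 : U = ∅ := by
    rw [← Finset.card_eq_zero]
    have : U.card < 1 := by exact_mod_cast hU0
    omega
  refine ⟨⟨E, hEk⟩, hElin, ?_, hEm⟩
  · intro r₁ r₂
    obtain ⟨σ, hσ⟩ := exists_permOrder r₁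
    obtain ⟨τ, hτ⟩ := exists_permOrder r₂
    have hnot : (σ, τ) ∉ U := by rw [hU1]; exact Finset.notMem_empty _
    rw [hU, Finset.mem_filter] at hnot
    push Not at hnot
    obtain ⟨e, he, hcons⟩ := hnot (Finset.mem_univ _)
    exact ⟨e, he, MonoConsistent.congr (r₁ := permOrder σ) (r₂ := permOrder τ) hσ hτ ((hhit _ _).1 hcons)⟩

end KGraph

namespace KGraph

/-- The greedy choice succeeds on `n` vertices, with about `n ^ 2 / k ^ 6` edges, as soon as
`n ≥ 4 k ^ 6 N (log n + 1)`, where `N` is the binomial coefficient `((k - 1) ^ 2 + 1).choose k`. -/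
theorem exists_isLinear_strongES_of_log_le {k n : ℕ} (hk : 2 ≤ k)
    (h : 4 * (k : ℝ) ^ 6 * (((k - 1) ^ 2 + 1).choose k : ℝ) * (Real.log n + 1) ≤ n) :
    ∃ H : KGraph k (Fin n), H.IsLinear ∧ H.StrongES ∧
      (H.edges.card : ℝ) ≤ (n : ℝ) ^ 2 / (k : ℝ) ^ 6 := by
  set N := ((k - 1) ^ 2 + 1).choose k with hN
  have hkM : k ≤ (k - 1) ^ 2 + 1 := le_sub_one_sq_add_one (by omega)
  have hN1 : (1 : ℝ) ≤ N := by exact_mod_cast (Nat.choose_pos hkM : 0 < N)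
  have hk2 : (2 : ℝ) ≤ k := by exact_mod_cast hk
  have hk0 : (0 : ℝ) < k := by linarith
  have hlog : 0 ≤ Real.log n := Real.log_natCast_nonneg n
  have hkn6 : 4 * (k : ℝ) ^ 6 * N ≤ n := by
    refine le_trans ?_ h
    exact le_mul_of_one_le_right (by positivity) (by linarith)
  have hkn : (k : ℝ) ^ 2 ≤ n := by
    calc (k : ℝ) ^ 2 ≤ k ^ 6 := pow_le_pow_right₀ (by linarith) (by norm_num)
      _ ≤ 4 * (k : ℝ) ^ 6 * N := by nlinarith [pow_pos hk0 6]
      _ ≤ n := hkn6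
  have hkn' : k ^ 2 ≤ n := by exact_mod_cast hkn
  have hn1 : (1 : ℝ) ≤ n := by nlinarith
  have hM : (k - 1) ^ 2 + 1 ≤ k ^ 2 := by
    obtain ⟨j, rfl⟩ : ∃ j, k = j + 1 := ⟨k - 1, by omega⟩
    rw [Nat.add_sub_cancel]
    nlinarith
  set m := n ^ 2 / k ^ 6 with hm
  have hm6 : (m : ℝ) * k ^ 6 ≤ n ^ 2 := by exact_mod_cast Nat.div_mul_le_self (n ^ 2) (k ^ 6)
  have hmlow : (n : ℝ) ^ 2 / k ^ 6 < m + 1 := by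
    rw [div_lt_iff₀ (by positivity)]
    exact_mod_cast Nat.lt_mul_of_div_lt (Nat.lt_succ_self m) (by positivity : 0 < k ^ 6)
  -- the `+ 1` in the hypothesis absorbs the rounding in `m`
  have hm1 : 4 * N * n * Real.log n < m := by
    have h1 : 4 * N * n * (Real.log n + 1) ≤ (n : ℝ) ^ 2 / k ^ 6 := by
      rw [le_div_iff₀ (by positivity)]
      calc 4 * N * n * (Real.log n + 1) * (k : ℝ) ^ 6
          = (n : ℝ) * (4 * (k : ℝ) ^ 6 * N * (Real.log n + 1)) := by ring
        _ ≤ (n : ℝ) * n := by gcongr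
        _ = _ := by ring
    have h2 : (1 : ℝ) ≤ N * n := one_le_mul_of_one_le_of_one_le hN1 hn1
    nlinarith
  obtain ⟨H, hH, hES, hHm⟩ := exists_isLinear_strongES (m := m) hk (hM.trans hkn') (by
      have hM' : (((k - 1) ^ 2 + 1 : ℕ) : ℝ) = ((k : ℝ) - 1) ^ 2 + 1 := by
        push_cast [Nat.cast_sub (by omega : 1 ≤ k)]
        ring
      have hx : (1 : ℝ) ≤ (k : ℝ) - 1 := by linarith
      set x := (k : ℝ) - 1 with hxk
      have hkx : (k : ℝ) = x + 1 := by rw [hxk]; ring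
      have hreal : (2 : ℝ) * m * (k.choose 2 : ℕ) * (((k - 1) ^ 2 + 1).choose 2 : ℕ) ≤
          (n.choose 2 : ℕ) := by
        rw [Nat.cast_choose_two, Nat.cast_choose_two, Nat.cast_choose_two, hM', ← hxk]
        have h1 : (m : ℝ) * k ^ 3 * x ^ 3 ≤ n * (n - 1) := by
          have h2 : (n : ℝ) * x ^ 3 ≤ k ^ 3 * (n - 1) := by
            have h4 : (k : ℝ) ≤ k ^ 3 - x ^ 3 := by rw [hkx]; nlinarith
            have h5 : (k : ℝ) ^ 2 * k ≤ n * (k ^ 3 - x ^ 3) := by gcongr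
            nlinarith
          refine le_of_mul_le_mul_left ?_ (pow_pos hk0 3)
          calc (k : ℝ) ^ 3 * (m * k ^ 3 * x ^ 3) = (m * k ^ 6) * x ^ 3 := by ring
            _ ≤ n ^ 2 * x ^ 3 := by gcongr
            _ = n * (n * x ^ 3) := by ring
            _ ≤ n * (k ^ 3 * (n - 1)) := by gcongr
            _ = _ := by ring
        have h6 : x ^ 2 + 1 ≤ (k : ℝ) ^ 2 := by rw [hkx]; nlinarith
        calc (2 : ℝ) * m * (k * x / 2) * ((x ^ 2 + 1) * (x ^ 2 + 1 - 1) / 2)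
            = (m * k * x ^ 3) * (x ^ 2 + 1) / 2 := by ring
          _ ≤ (m * k * x ^ 3) * (k : ℝ) ^ 2 / 2 := by gcongr
          _ = (m * k ^ 3 * x ^ 3) / 2 := by ring
          _ ≤ _ := by gcongr
      exact_mod_cast hreal) (by
      have h1 : ((n ! : ℕ) : ℝ) ≤ Real.exp (n * Real.log n) := by
        have h2 : ((n ! : ℕ) : ℝ) ≤ (n : ℝ) ^ n := by exact_mod_cast Nat.factorial_le_pow n
        rwa [Real.exp_nat_mul, Real.exp_log (by linarith)]
      have h3 : 1 - 1 / (2 * (N : ℝ)) ≤ Real.exp (-(1 / (2 * N))) := by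
        have := Real.add_one_le_exp (-(1 / (2 * (N : ℝ))))
        linarith
      have h4 : 0 ≤ 1 - 1 / (2 * (N : ℝ)) := by
        rw [sub_nonneg, div_le_one (by positivity)]; linarith
      calc ((n ! : ℕ) : ℝ) ^ 2 * (1 - 1 / (2 * (N : ℝ))) ^ m
          ≤ Real.exp (n * Real.log n) ^ 2 * Real.exp (-(1 / (2 * N))) ^ m := by gcongr
        _ = Real.exp (2 * (n * Real.log n) + m * (-(1 / (2 * N)))) := by
          rw [← Real.exp_nat_mul, ← Real.exp_nat_mul, ← Real.exp_add]; norm_num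
        _ < 1 := by
          rw [Real.exp_lt_one_iff]
          have h5 : 2 * (n * Real.log n) < m / (2 * N) := by
            rw [lt_div_iff₀ (by positivity)]; linarith
          have h6 : (m : ℝ) * (-(1 / (2 * N))) = - (m / (2 * N)) := by ring
          rw [h6]; linarith)
  refine ⟨H, hH, hES, ?_⟩
  rw [le_div_iff₀ (by positivity)]
  refine le_trans ?_ hm6
  gcongr

theorem exists_finite_isLinear_strongES {k : ℕ} (hk : 2 ≤ k) :
    ∃ (n : ℕ) (H : KGraph k (Fin n)), H.IsLinear ∧ H.StrongES := by
  set c : ℝ := 4 * (k : ℝ) ^ 6 * (((k - 1) ^ 2 + 1).choose k : ℝ) with hc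
  have hlog : Tendsto (fun x : ℝ => x - c * (Real.log x + 1)) atTop atTop := by
    have h1 : (fun x : ℝ => c * (Real.log x + 1)) =o[atTop] (fun x : ℝ => x) := by
      refine IsLittleO.const_mul_left ?_ _
      exact Real.isLittleO_log_id_atTop.add (isLittleO_const_id_atTop 1)
    have h2 : (fun x : ℝ => x - c * (Real.log x + 1)) ~[atTop] (fun x : ℝ => x) :=
      IsEquivalent.refl.sub_isLittleO h1
    exact h2.symm.tendsto_atTop tendsto_id
  obtain ⟨n, hn⟩ := ((hlog.comp tendsto_natCast_atTop_atTop).eventually_ge_atTop 0).exists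
  obtain ⟨H, hH, hES, -⟩ := exists_isLinear_strongES_of_log_le (n := n) hk
    (by simp only [Function.comp] at hn; linarith)
  exact ⟨n, H, hH, hES⟩

theorem StrongES.weakES {k : ℕ} {V : Type*} [Finite V] {H : KGraph k V} (h : H.StrongES) :
    H.WeakES := by
  obtain ⟨n, ⟨f⟩⟩ := Finite.exists_equiv_fin V
  exact ⟨LinearOrder.lift' f f.injective, h _⟩

theorem strongEdgeCounts_subset (k : ℕ) : strongEdgeCounts k ⊆ weakEdgeCounts k := by
  rintro m ⟨V, hV, H, hH, hES, hm⟩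
  exact ⟨V, hV, H, hH, hES.weakES, hm⟩

theorem strongVertexCounts_subset (k : ℕ) : strongVertexCounts k ⊆ weakVertexCounts k := by
  rintro m ⟨V, hV, H, hH, hES, hm⟩
  exact ⟨V, hV, H, hH, hES.weakES, hm⟩

theorem strongEdgeCounts_nonempty {k : ℕ} (hk : 2 ≤ k) : (strongEdgeCounts k).Nonempty := by
  obtain ⟨n, H, hH, hES⟩ := exists_finite_isLinear_strongES hk
  exact ⟨_, Fin n, inferInstance, H, hH, hES, rfl⟩

theorem strongVertexCounts_nonempty {k : ℕ} (hk : 2 ≤ k) : (strongVertexCounts k).Nonempty := by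
  obtain ⟨n, H, hH, hES⟩ := exists_finite_isLinear_strongES hk
  exact ⟨_, Fin n, inferInstance, H, hH, hES, rfl⟩

end KGraph

/-! ### Asymptotics -/

/-- `∏ (1 - x_i)`, where `x_i = (2 k - 2 + i) / k ^ 2` for `i < k`; the sum of the `x_i` is
`5 (k - 1) / (2 k)`, and the squares are negligible. -/
theorem tendsto_prod_one_sub :
    Tendsto (fun k : ℕ => ∏ i ∈ Finset.range k, (1 - (2 * (k : ℝ) - 2 + i) / (k : ℝ) ^ 2)) atTop
      (𝓝 (Real.exp (-(5 / 2)))) := by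
  have hinv : Tendsto (fun k : ℕ => 1 / (k : ℝ)) atTop (𝓝 0) := tendsto_one_div_atTop_nhds_zero_nat
  have hsum : ∀ k : ℕ, 1 ≤ k → ∑ i ∈ Finset.range k, (2 * (k : ℝ) - 2 + i) / (k : ℝ) ^ 2 =
      5 / 2 - 5 / 2 * (1 / (k : ℝ)) := by
    intro k hk
    have hk0 : (k : ℝ) ≠ 0 := by positivity
    rw [← Finset.sum_div, Finset.sum_add_distrib, Finset.sum_const, Finset.card_range,
      nsmul_eq_mul]
    have h1 : ∑ i ∈ Finset.range k, (i : ℝ) = k * (k - 1) / 2 := by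
      rw [← Nat.cast_sum, Finset.sum_range_id, ← Nat.choose_two_right, Nat.cast_choose_two]
    rw [h1]
    field_simp
    ring
  have hlow : Tendsto
      (fun k : ℕ => Real.exp (-(5 / 2 - 5 / 2 * (1 / (k : ℝ))) - 18 * (1 / (k : ℝ))))
      atTop (𝓝 (Real.exp (-(5 / 2)))) := by
    refine (Real.continuous_exp.tendsto _).comp ?_
    have := ((hinv.const_mul (5 / 2)).const_sub (5 / 2)).neg.sub (hinv.const_mul 18)
    simpa using this
  have hup : Tendsto (fun k : ℕ => Real.exp (-(5 / 2 - 5 / 2 * (1 / (k : ℝ)))))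
      atTop (𝓝 (Real.exp (-(5 / 2)))) := by
    refine (Real.continuous_exp.tendsto _).comp ?_
    have := ((hinv.const_mul (5 / 2)).const_sub (5 / 2)).neg
    simpa using this
  have hx : ∀ k : ℕ, 6 ≤ k → ∀ i ∈ Finset.range k, 0 ≤ (2 * (k : ℝ) - 2 + i) / (k : ℝ) ^ 2 ∧
      (2 * (k : ℝ) - 2 + i) / (k : ℝ) ^ 2 ≤ 3 / k ∧ (3 : ℝ) / k ≤ 1 / 2 := by
    intro k hk i hi
    have hk6 : (6 : ℝ) ≤ k := by exact_mod_cast hk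
    have hik : (i : ℝ) ≤ k := by exact_mod_cast (Finset.mem_range.1 hi).le
    have hi0 : (0 : ℝ) ≤ i := Nat.cast_nonneg i
    refine ⟨div_nonneg (by linarith) (by positivity), ?_, ?_⟩
    · rw [div_le_div_iff₀ (by positivity) (by positivity)]; nlinarith
    · rw [div_le_div_iff₀ (by positivity) (by positivity)]; linarith
  refine tendsto_of_tendsto_of_tendsto_of_le_of_le' hlow hup ?_ ?_
  · filter_upwards [eventually_ge_atTop 6] with k hk
    have hk0 : (0 : ℝ) < k := by positivity
    rw [← hsum k (by omega)]
    have h18 : 18 * (1 / (k : ℝ)) = ∑ i ∈ Finset.range k, 2 * (3 / (k : ℝ)) ^ 2 := by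
      rw [Finset.sum_const, Finset.card_range, nsmul_eq_mul]; field_simp; norm_num
    rw [h18, ← Finset.sum_neg_distrib, ← Finset.sum_sub_distrib, Real.exp_sum]
    refine Finset.prod_le_prod (fun i _ => (Real.exp_pos _).le) fun i hi => ?_
    obtain ⟨hx0, hx3, hx2⟩ := hx k hk i hi
    set x := (2 * (k : ℝ) - 2 + i) / (k : ℝ) ^ 2
    -- `1 / (1 - x) = 1 + x / (1 - x) ≤ exp (x + 2 x ^ 2)` for `0 ≤ x ≤ 1 / 2`
    have hpos : 0 < 1 - x := by linarith
    have h1 : 1 ≤ (1 - x) * Real.exp (x + 2 * x ^ 2) := by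
      have := Real.add_one_le_exp (x + 2 * x ^ 2)
      calc 1 ≤ (1 - x) * (x + 2 * x ^ 2 + 1) := by nlinarith [mul_nonneg hx0 hx0]
        _ ≤ _ := by gcongr
    have h2 : Real.exp (-(x + 2 * x ^ 2)) ≤ 1 - x := by
      rw [Real.exp_neg, inv_le_iff_one_le_mul₀ (Real.exp_pos _)]; exact h1
    refine le_trans (Real.exp_le_exp.2 ?_) h2
    have : x ^ 2 ≤ (3 / (k : ℝ)) ^ 2 := by gcongr
    linarith
  · filter_upwards [eventually_ge_atTop 6] with k hk
    rw [← hsum k (by omega), ← Finset.sum_neg_distrib, Real.exp_sum]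
    refine Finset.prod_le_prod (fun i hi => ?_) fun i hi => ?_
    · obtain ⟨hx0, hx3, hx2⟩ := hx k hk i hi
      linarith
    · have := Real.add_one_le_exp (-((2 * (k : ℝ) - 2 + i) / (k : ℝ) ^ 2))
      linarith

/-- The product `∏ (1 - x_i)` as the ratio between a binomial coefficient and powers. -/
theorem choose_mul_factorial_eq_prod {k : ℕ} (hk : 2 ≤ k) :
    (((k - 1) ^ 2 + 1).choose k : ℝ) * (k ! : ℕ) =
      (k : ℝ) ^ (2 * k) * ∏ i ∈ Finset.range k, (1 - (2 * (k : ℝ) - 2 + i) / (k : ℝ) ^ 2) := by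
  have hk0 : (k : ℝ) ≠ 0 := by positivity
  have h1 : ((k - 1) ^ 2 + 1).choose k * k ! = ((k - 1) ^ 2 + 1).descFactorial k := by
    rw [Nat.descFactorial_eq_factorial_mul_choose, mul_comm]
  have h2 : (((k - 1) ^ 2 + 1).choose k : ℝ) * (k ! : ℕ) =
      ((((k - 1) ^ 2 + 1).descFactorial k : ℕ) : ℝ) := by exact_mod_cast h1
  rw [h2, Nat.descFactorial_eq_prod_range, pow_mul]
  rw [show ((k : ℝ) ^ 2) ^ k = ∏ i ∈ Finset.range k, (k : ℝ) ^ 2 by simp,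
    ← Finset.prod_mul_distrib]
  push_cast
  refine Finset.prod_congr rfl fun i hi => ?_
  have hik := Finset.mem_range.1 hi
  have hle : i ≤ (k - 1) ^ 2 + 1 := by
    obtain ⟨j, rfl⟩ : ∃ j, k = j + 1 := ⟨k - 1, by omega⟩
    rw [Nat.add_sub_cancel]
    nlinarith
  rw [Nat.cast_sub hle]
  push_cast [Nat.cast_sub (by omega : 1 ≤ k)]
  field_simp
  ring

/-- Stirling's formula for the binomial coefficient, in the form
`((k - 1) ^ 2 + 1).choose k = ρ k * k ^ k * exp k / (√(2 π k) * exp (5 / 2))` with `ρ k → 1`. -/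
theorem exists_choose_eq_mul :
    ∃ ρ : ℕ → ℝ, Tendsto ρ atTop (𝓝 1) ∧ ∀ k : ℕ, 2 ≤ k →
      (((k - 1) ^ 2 + 1).choose k : ℝ) =
        ρ k * ((k : ℝ) ^ k * Real.exp k / (√(2 * Real.pi * k) * Real.exp (5 / 2))) := by
  refine ⟨fun k => (∏ i ∈ Finset.range k, (1 - (2 * (k : ℝ) - 2 + i) / (k : ℝ) ^ 2)) *
    Real.exp (5 / 2) * √Real.pi / Stirling.stirlingSeq k, ?_, fun k hk => ?_⟩
  · have hpi : √Real.pi ≠ 0 := by positivity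
    have h := ((tendsto_prod_one_sub.mul_const (Real.exp (5 / 2))).mul_const (√Real.pi)).div
      Stirling.tendsto_stirlingSeq_sqrt_pi hpi
    rw [← Real.exp_add, neg_add_cancel, Real.exp_zero, one_mul, div_self hpi] at h
    exact h
  · have hk0 : (0 : ℝ) < k := by positivity
    have hfac : (0 : ℝ) < (k ! : ℕ) := by exact_mod_cast Nat.factorial_pos k
    have h := choose_mul_factorial_eq_prod hk
    rw [← eq_div_iff hfac.ne'] at h
    have hs : Stirling.stirlingSeq k =
        (k ! : ℕ) / (√(2 * k : ℝ) * (k / Real.exp 1) ^ k) := rfl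
    beta_reduce
    rw [h, hs]
    have hexp : (k / Real.exp 1) ^ k = (k : ℝ) ^ k / Real.exp k := by
      rw [div_pow, ← Real.exp_nat_mul, mul_one]
    rw [hexp, Real.sqrt_mul (by positivity) (k : ℝ), Real.sqrt_mul (by positivity) (k : ℝ),
      Real.sqrt_mul (by positivity) Real.pi]
    field_simp
    ring

theorem isEquivalent_edgeFormula :
    (fun k : ℕ =>
        16 * (k : ℝ) ^ 8 * Real.log k ^ 2 * (((k - 1) ^ 2 + 1).choose k : ℝ) ^ 2) ~[atTop]
      (fun k : ℕ => 8 * (k : ℝ) ^ (2 * k + 7) * Real.exp (2 * k) * Real.log k ^ 2 /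
        (Real.pi * Real.exp 5)) := by
  obtain ⟨ρ, hρ, h⟩ := exists_choose_eq_mul
  refine isEquivalent_iff_exists_eq_mul.2 ⟨fun k => ρ k ^ 2, by simpa using hρ.pow 2, ?_⟩
  filter_upwards [eventually_ge_atTop 2] with k hk
  have hk0 : (0 : ℝ) < k := by positivity
  simp only [Pi.mul_apply]
  rw [h k hk]
  have h1 : √(2 * Real.pi * k) ^ 2 = 2 * Real.pi * k := Real.sq_sqrt (by positivity)
  have h2 : Real.exp (5 / 2) ^ 2 = Real.exp 5 := by rw [← Real.exp_nat_mul]; norm_num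
  have h3 : Real.exp (2 * k) = Real.exp k ^ 2 := by rw [← Real.exp_nat_mul]; norm_num
  rw [mul_pow, div_pow, mul_pow, mul_pow, h1, h2, h3]
  field_simp
  ring

theorem isEquivalent_vertexFormula :
    (fun k : ℕ => 4 * (k : ℝ) ^ 7 * Real.log k * (((k - 1) ^ 2 + 1).choose k : ℝ)) ~[atTop]
      (fun k : ℕ => 2 * Real.sqrt 2 * (k : ℝ) ^ ((k : ℝ) + 13 / 2) * Real.exp k * Real.log k /
        (Real.sqrt Real.pi * Real.exp (5 / 2))) := by
  obtain ⟨ρ, hρ, h⟩ := exists_choose_eq_mul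
  refine isEquivalent_iff_exists_eq_mul.2 ⟨ρ, hρ, ?_⟩
  filter_upwards [eventually_ge_atTop 2] with k hk
  have hk0 : (0 : ℝ) < k := by positivity
  simp only [Pi.mul_apply]
  rw [h k hk]
  have h1 : (k : ℝ) ^ ((k : ℝ) + 13 / 2) = (k : ℝ) ^ k * k ^ 6 * √k := by
    rw [show (k : ℝ) + 13 / 2 = (k : ℝ) + (6 : ℕ) + 1 / 2 by norm_num; ring,
      Real.rpow_add hk0, Real.rpow_add hk0, Real.rpow_natCast, Real.rpow_natCast,
      Real.sqrt_eq_rpow]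
  have h2 : √2 ^ 2 = (2 : ℝ) := Real.sq_sqrt (by norm_num)
  have h3 : √(k : ℝ) ^ 2 = k := Real.sq_sqrt hk0.le
  rw [h1, Real.sqrt_mul (by positivity) (k : ℝ), Real.sqrt_mul (by positivity) Real.pi]
  field_simp
  rw [h2, h3]
  ring

/-- An eventual upper bound by a quantity asymptotic to `b` is a bound by `(1 + o(1)) b`. -/
theorem exists_tendsto_zero_le_one_add_mul {a b c : ℕ → ℝ} {K : ℕ} (hb : ∀ k, K ≤ k → 0 < b k)
    (hac : ∀ᶠ k in atTop, a k ≤ c k) (hcb : Tendsto (fun k => c k / b k) atTop (𝓝 1)) :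
    ∃ ε : ℕ → ℝ, Tendsto ε atTop (𝓝 0) ∧ ∀ k, K ≤ k → a k ≤ (1 + ε k) * b k := by
  -- the truncation at `0` is what makes `ε` tend to `0` although `a` has no lower bound
  refine ⟨fun k => max 0 (a k / b k - 1), ?_, fun k hk => ?_⟩
  · have hup : Tendsto (fun k => max 0 (c k / b k - 1)) atTop (𝓝 0) := by
      have := (tendsto_const_nhds (x := (0 : ℝ))).max (hcb.sub_const 1)
      simpa using this
    refine tendsto_of_tendsto_of_tendsto_of_le_of_le' tendsto_const_nhds hup
      (Eventually.of_forall fun k => le_max_left _ _) ?_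
    filter_upwards [hac, eventually_ge_atTop K] with k hk hkK
    have := hb k hkK
    gcongr
  · have hbk := hb k hk
    calc a k = (1 + (a k / b k - 1)) * b k := by field_simp; ring
      _ ≤ _ := by gcongr; exact le_max_right _ _

/-! ### The four minima -/

/-- The number of vertices used for uniformity `k`, before rounding up. The last factor is chosen
asymptotic to `k log k` and, for large `k`, at least `log n + 1`, where `n` is the rounded value. -/
noncomputable def vertexBound (k : ℕ) : ℝ :=
  4 * (k : ℝ) ^ 6 * (((k - 1) ^ 2 + 1).choose k : ℝ) * (k * Real.log k + 2 * k)

theorem log_choose_le {k : ℕ} (hk : 2 ≤ k) :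
    Real.log (((k - 1) ^ 2 + 1).choose k : ℝ) ≤ k * Real.log k + k := by
  obtain ⟨j, rfl⟩ : ∃ j, k = j + 1 := ⟨k - 1, by omega⟩
  have hkM : j + 1 ≤ (j + 1 - 1) ^ 2 + 1 := by rw [Nat.add_sub_cancel]; nlinarith
  have hM : (j + 1 - 1) ^ 2 + 1 ≤ (j + 1) ^ 2 := by rw [Nat.add_sub_cancel]; nlinarith
  set k := j + 1
  have hk0 : (0 : ℝ) < k := by positivity
  have hfac : (0 : ℝ) < (k ! : ℕ) := by exact_mod_cast Nat.factorial_pos k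
  have hN : (0 : ℝ) < (((k - 1) ^ 2 + 1).choose k : ℕ) := by exact_mod_cast Nat.choose_pos hkM
  have h1 : (((k - 1) ^ 2 + 1).choose k : ℝ) ≤ (k : ℝ) ^ k * Real.exp k := by
    have h2 : (((k - 1) ^ 2 + 1).choose k : ℝ) ≤ (((k - 1) ^ 2 + 1 : ℕ) : ℝ) ^ k / (k ! : ℕ) :=
      Nat.choose_le_pow_div k _
    have h3 : (((k - 1) ^ 2 + 1 : ℕ) : ℝ) ≤ (k : ℝ) ^ 2 := by exact_mod_cast hM
    have h4 : (k : ℝ) ^ k / (k ! : ℕ) ≤ Real.exp k := Real.pow_div_factorial_le_exp _ hk0.le k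
    calc (((k - 1) ^ 2 + 1).choose k : ℝ) ≤ ((k : ℝ) ^ 2) ^ k / (k ! : ℕ) := by
          refine h2.trans ?_
          gcongr
      _ = (k : ℝ) ^ k * ((k : ℝ) ^ k / (k ! : ℕ)) := by ring
      _ ≤ _ := by gcongr
  refine (Real.log_le_log hN h1).trans_eq ?_
  rw [Real.log_mul (by positivity) (by positivity), Real.log_exp, Real.log_pow]

theorem eventually_log_ceil_vertexBound_le :
    ∀ᶠ k : ℕ in atTop, 2 ≤ k ∧
      4 * (k : ℝ) ^ 6 * (((k - 1) ^ 2 + 1).choose k : ℝ) *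
        (Real.log (⌈vertexBound k⌉₊ : ℕ) + 1) ≤ (⌈vertexBound k⌉₊ : ℕ) := by
  have hlog : ∀ᶠ k : ℕ in atTop, Real.log k ≤ 1 / 16 * k := by
    have := (Real.isLittleO_log_id_atTop.bound (by norm_num : (0 : ℝ) < 1 / 16))
    filter_upwards [tendsto_natCast_atTop_atTop.eventually this] with k hk
    have h := (le_abs_self _).trans hk
    simpa using h
  filter_upwards [hlog, eventually_ge_atTop 16] with k hlogk hk
  refine ⟨by omega, ?_⟩
  refine le_trans ?_ (Nat.le_ceil _)
  have hk16 : (16 : ℝ) ≤ k := by exact_mod_cast hk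
  have hk0 : (0 : ℝ) < k := by linarith
  have hkM : k ≤ (k - 1) ^ 2 + 1 := le_sub_one_sq_add_one (by omega)
  have hN1 : (1 : ℝ) ≤ (((k - 1) ^ 2 + 1).choose k : ℕ) := by
    exact_mod_cast Nat.choose_pos hkM
  have hlogN := log_choose_le (by omega : 2 ≤ k)
  have hlogk0 : 0 ≤ Real.log k := Real.log_natCast_nonneg k
  rw [vertexBound]
  set N : ℝ := (((k - 1) ^ 2 + 1).choose k : ℝ)
  set L : ℝ := k * Real.log k + 2 * k with hL
  have hL1 : 1 ≤ L := by nlinarith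
  have hLk : L ≤ k ^ 2 := by nlinarith
  have hceil : (⌈4 * (k : ℝ) ^ 6 * N * L⌉₊ : ℝ) ≤ k ^ 9 * N := by
    have h1 : 1 ≤ (k : ℝ) ^ 6 * N * L :=
      one_le_mul_of_one_le_of_one_le
        (one_le_mul_of_one_le_of_one_le (one_le_pow₀ (by linarith)) hN1) hL1
    have h2 := (Nat.ceil_lt_add_one (by positivity : 0 ≤ 4 * (k : ℝ) ^ 6 * N * L)).le
    -- the factor `5` leaves room for rounding up
    calc (⌈4 * (k : ℝ) ^ 6 * N * L⌉₊ : ℝ) ≤ 5 * ((k : ℝ) ^ 6 * N * L) := by linarith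
      _ ≤ k * ((k : ℝ) ^ 6 * N * k ^ 2) := by gcongr; linarith
      _ = _ := by ring
  have hpos : 0 < (⌈4 * (k : ℝ) ^ 6 * N * L⌉₊ : ℝ) :=
    lt_of_lt_of_le (by positivity) (Nat.le_ceil _)
  have hlogn : Real.log (⌈4 * (k : ℝ) ^ 6 * N * L⌉₊ : ℝ) + 1 ≤ L := by
    have h1 := Real.log_le_log hpos hceil
    rw [Real.log_mul (by positivity) (by positivity), Real.log_pow] at h1
    push_cast at h1
    rw [hL]
    linarith
  gcongr

theorem tendsto_log_natCast_atTop : Tendsto (fun k : ℕ => Real.log k) atTop atTop :=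
  Real.tendsto_log_atTop.comp tendsto_natCast_atTop_atTop

theorem vertexFormula_pos {k : ℕ} (hk : 2 ≤ k) :
    0 < 4 * (k : ℝ) ^ 7 * Real.log k * (((k - 1) ^ 2 + 1).choose k : ℝ) := by
  have hkM : k ≤ (k - 1) ^ 2 + 1 := le_sub_one_sq_add_one (by omega)
  have hN : (0 : ℝ) < (((k - 1) ^ 2 + 1).choose k : ℕ) := by exact_mod_cast Nat.choose_pos hkM
  have hk0 : (0 : ℝ) < k := by positivity
  have hlog : 0 < Real.log k := Real.log_pos (by exact_mod_cast (by omega : 1 < k))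
  positivity

theorem tendsto_ceil_vertexBound_div :
    Tendsto (fun k : ℕ => (⌈vertexBound k⌉₊ : ℝ) /
      (4 * (k : ℝ) ^ 7 * Real.log k * (((k - 1) ^ 2 + 1).choose k : ℝ))) atTop (𝓝 1) := by
  have hlog2 : Tendsto (fun k : ℕ => 2 / Real.log k) atTop (𝓝 0) :=
    tendsto_const_nhds.div_atTop tendsto_log_natCast_atTop
  have hlow : Tendsto (fun k : ℕ => 1 + 2 / Real.log k) atTop (𝓝 1) := by
    simpa using hlog2.const_add 1
  have hup : Tendsto (fun k : ℕ => 1 + 2 / Real.log k + 2 / Real.log k) atTop (𝓝 1) := by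
    simpa using hlow.add hlog2
  have hratio : ∀ k : ℕ, 2 ≤ k → vertexBound k =
      (1 + 2 / Real.log k) *
        (4 * (k : ℝ) ^ 7 * Real.log k * (((k - 1) ^ 2 + 1).choose k : ℝ)) := by
    intro k hk
    have hlog : Real.log k ≠ 0 := (Real.log_pos (by exact_mod_cast (by omega : 1 < k))).ne'
    rw [vertexBound]
    field_simp
  refine tendsto_of_tendsto_of_tendsto_of_le_of_le' hlow hup ?_ ?_
  · filter_upwards [eventually_ge_atTop 2] with k hk
    rw [le_div_iff₀ (vertexFormula_pos hk), ← hratio k hk]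
    exact Nat.le_ceil _
  · filter_upwards [eventually_ge_atTop 2] with k hk
    have hkM : k ≤ (k - 1) ^ 2 + 1 := le_sub_one_sq_add_one (by omega)
    have hN : (1 : ℝ) ≤ (((k - 1) ^ 2 + 1).choose k : ℕ) := by
      exact_mod_cast Nat.choose_pos hkM
    have hk1 : (1 : ℝ) ≤ k := by exact_mod_cast (by omega : 1 ≤ k)
    have hlog : 0 < Real.log k := Real.log_pos (by exact_mod_cast (by omega : 1 < k))
    have hvb : 0 ≤ vertexBound k := by rw [vertexBound]; positivity
    rw [div_le_iff₀ (vertexFormula_pos hk), add_mul, ← hratio k hk]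
    refine (Nat.ceil_lt_add_one hvb).le.trans (add_le_add_right ?_ _)
    have h1 : (1 : ℝ) ≤ (k : ℝ) ^ 7 * (((k - 1) ^ 2 + 1).choose k : ℕ) :=
      one_le_mul_of_one_le_of_one_le (one_le_pow₀ hk1) hN
    have h2 : 2 / Real.log k *
        (4 * (k : ℝ) ^ 7 * Real.log k * (((k - 1) ^ 2 + 1).choose k : ℝ)) =
        8 * ((k : ℝ) ^ 7 * (((k - 1) ^ 2 + 1).choose k : ℕ)) := by
      field_simp; norm_num
    rw [h2]
    linarith

namespace KGraph

theorem eventually_nsES_le : ∀ᶠ k : ℕ in atTop, (nsES k : ℝ) ≤ ⌈vertexBound k⌉₊ := by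
  filter_upwards [eventually_log_ceil_vertexBound_le] with k hk
  obtain ⟨H, hH, hES, -⟩ := exists_isLinear_strongES_of_log_le hk.1 hk.2
  have h : nsES k ≤ ⌈vertexBound k⌉₊ :=
    Nat.sInf_le ⟨Fin ⌈vertexBound k⌉₊, inferInstance, H, hH, hES, Nat.card_fin _⟩
  exact_mod_cast h

theorem eventually_fsES_le :
    ∀ᶠ k : ℕ in atTop, (fsES k : ℝ) ≤ (⌈vertexBound k⌉₊ : ℝ) ^ 2 / (k : ℝ) ^ 6 := by
  filter_upwards [eventually_log_ceil_vertexBound_le] with k hk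
  obtain ⟨H, hH, hES, hm⟩ := exists_isLinear_strongES_of_log_le hk.1 hk.2
  refine le_trans ?_ hm
  have h : fsES k ≤ H.edges.card :=
    Nat.sInf_le ⟨Fin ⌈vertexBound k⌉₊, inferInstance, H, hH, hES, rfl⟩
  exact_mod_cast h

theorem le_fwES {k : ℕ} (hk : 2 ≤ k) :
    ((k ! : ℕ) : ℝ) ^ 2 / (8 * Real.exp 1 ^ 2 * (k : ℝ) ^ 4) ≤ (fwES k : ℝ) := by
  obtain ⟨V, hV, H, hH, hES, hm⟩ :=
    Nat.sInf_mem ((strongEdgeCounts_nonempty hk).mono (strongEdgeCounts_subset k))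
  rw [fwES, ← hm]
  exact le_card_edges_of_weakES hk hH hES

theorem le_nwES {k : ℕ} (hk : 2 ≤ k) :
    ((k : ℝ) - 1) * (((k - 1)! : ℕ) : ℝ) / (2 * Real.exp 1 * (k : ℝ)) ≤ (nwES k : ℝ) := by
  obtain ⟨V, hV, H, hH, hES, hm⟩ :=
    Nat.sInf_mem ((strongVertexCounts_nonempty hk).mono (strongVertexCounts_subset k))
  rw [nwES, ← hm]
  exact le_card_of_weakES hk hH hES

theorem fwES_le_fsES {k : ℕ} (hk : 2 ≤ k) : fwES k ≤ fsES k :=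
  Nat.sInf_le (strongEdgeCounts_subset k (Nat.sInf_mem (strongEdgeCounts_nonempty hk)))

theorem nwES_le_nsES {k : ℕ} (hk : 2 ≤ k) : nwES k ≤ nsES k :=
  Nat.sInf_le (strongVertexCounts_subset k (Nat.sInf_mem (strongVertexCounts_nonempty hk)))

end KGraph

theorem theorem1p9 :
    -- the four minima are minima of nonempty sets
    (∀ k : ℕ, 2 ≤ k →
      (KGraph.weakEdgeCounts k).Nonempty ∧ (KGraph.strongEdgeCounts k).Nonempty ∧
      (KGraph.weakVertexCounts k).Nonempty ∧ (KGraph.strongVertexCounts k).Nonempty) ∧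
    -- numbers of edges
    (∃ ε : ℕ → ℝ, Tendsto ε atTop (𝓝 0) ∧ ∀ k : ℕ, 2 ≤ k →
      ((k ! : ℕ) : ℝ) ^ 2 / (8 * Real.exp 1 ^ 2 * (k : ℝ) ^ 4) ≤ (KGraph.fwES k : ℝ) ∧
      KGraph.fwES k ≤ KGraph.fsES k ∧
      (KGraph.fsES k : ℝ) ≤ (1 + ε k) *
        (16 * (k : ℝ) ^ 8 * Real.log k ^ 2 * (((k - 1) ^ 2 + 1).choose k : ℝ) ^ 2)) ∧
    ((fun k : ℕ =>
        16 * (k : ℝ) ^ 8 * Real.log k ^ 2 * (((k - 1) ^ 2 + 1).choose k : ℝ) ^ 2) ~[atTop]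
      (fun k : ℕ => 8 * (k : ℝ) ^ (2 * k + 7) * Real.exp (2 * k) * Real.log k ^ 2 /
        (Real.pi * Real.exp 5))) ∧
    -- numbers of vertices
    (∃ ε : ℕ → ℝ, Tendsto ε atTop (𝓝 0) ∧ ∀ k : ℕ, 2 ≤ k →
      ((k : ℝ) - 1) * (((k - 1)! : ℕ) : ℝ) / (2 * Real.exp 1 * (k : ℝ)) ≤ (KGraph.nwES k : ℝ) ∧
      KGraph.nwES k ≤ KGraph.nsES k ∧
      (KGraph.nsES k : ℝ) ≤ (1 + ε k) *
        (4 * (k : ℝ) ^ 7 * Real.log k * (((k - 1) ^ 2 + 1).choose k : ℝ))) ∧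
    ((fun k : ℕ => 4 * (k : ℝ) ^ 7 * Real.log k * (((k - 1) ^ 2 + 1).choose k : ℝ)) ~[atTop]
      (fun k : ℕ => 2 * Real.sqrt 2 * (k : ℝ) ^ ((k : ℝ) + 13 / 2) * Real.exp k * Real.log k /
        (Real.sqrt Real.pi * Real.exp (5 / 2)))) := by
  refine ⟨fun k hk => ⟨?_, ?_, ?_, ?_⟩, ?_, isEquivalent_edgeFormula, ?_, isEquivalent_vertexFormula⟩
  · exact (KGraph.strongEdgeCounts_nonempty hk).mono (KGraph.strongEdgeCounts_subset k)
  · exact KGraph.strongEdgeCounts_nonempty hk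
  · exact (KGraph.strongVertexCounts_nonempty hk).mono (KGraph.strongVertexCounts_subset k)
  · exact KGraph.strongVertexCounts_nonempty hk
  · obtain ⟨ε, hε, h⟩ := exists_tendsto_zero_le_one_add_mul (K := 2)
      (a := fun k => (KGraph.fsES k : ℝ))
      (b := fun k => 16 * (k : ℝ) ^ 8 * Real.log k ^ 2 * (((k - 1) ^ 2 + 1).choose k : ℝ) ^ 2)
      (fun k hk => by
        have h1 := vertexFormula_pos hk
        have hk0 : (0 : ℝ) < k := by positivity
        have h2 : 0 < (4 * (k : ℝ) ^ 7 * Real.log k * (((k - 1) ^ 2 + 1).choose k : ℝ)) ^ 2 /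
          (k : ℝ) ^ 6 := by positivity
        refine lt_of_lt_of_eq h2 ?_
        field_simp
        ring)
      KGraph.eventually_fsES_le (by
        have h := tendsto_ceil_vertexBound_div.pow 2
        rw [one_pow] at h
        refine h.congr' ?_
        filter_upwards [eventually_ge_atTop 2] with k hk
        have hk0 : (k : ℝ) ≠ 0 := by positivity
        rw [div_pow, div_div]
        congr 1
        ring)
    exact ⟨ε, hε, fun k hk => ⟨KGraph.le_fwES hk, KGraph.fwES_le_fsES hk, h k hk⟩⟩
  · obtain ⟨ε, hε, h⟩ := exists_tendsto_zero_le_one_add_mul (K := 2)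
      (fun k hk => vertexFormula_pos hk) KGraph.eventually_nsES_le tendsto_ceil_vertexBound_div
    exact ⟨ε, hε, fun k hk => ⟨KGraph.le_nwES hk, KGraph.nwES_le_nsES hk, h k hk⟩⟩
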